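/- Let $g\ge 2$. Graphs are finite and may have loops and parallel edges. A tropical curve $C=(\Gamma,w,l)$ of genus $g$ is a connected graph $\Gamma$ with a weight function $w:V(\Gamma)\to\mathbb N$ such that every vertex of weight $0$ has valence at least $3$ (loops count twice) and $g(\Gamma)+|w|=g$, where $g(\Gamma)=\#E(\Gamma)-\#V(\Gamma)+1$ and $|w|=\sum_v w(v)$, together with a length function $l:E(\Gamma)\to\mathbb R_{>0}$. Let $M_g^{\rm tr}$ be the set of isomorphism classes of tropical curves of genus $g$, with the topology obtained by gluing the closed cones $\mathbb R_{\ge 0}^{E(\Gamma)}$ of all stable weighted graphs $(\Gamma,w)$ of genus $g$; a point of such a cone represents the tropical curve obtained by contracting the edges of length $0$, where contracting a non-loop adds the weights of its two ends and contracting a loop raises the weight of its vertex by one. A subset is open if and only if its preimage in each of these cones is open. For a stable weighted graph $(\Gamma,w)$ of genus $g$, the stratum of $(\Gamma,w)$ is the set of the tropical curves of combinatorial type $(\Gamma,w)$. Let $A_g^{\rm tr}$ be the set of isomorphism classes of pairs $(W/\Lambda,Q)$, with $W$ a real vector space of dimension $g$, $\Lambda\subset W$ a lattice of full rank and $Q$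 a positive semi-definite quadratic form on $W$ whose null space is spanned by vectors of $\Lambda$. The tropical Torelli map $t_g^{\rm tr}:M_g^{\rm tr}\to A_g^{\rm tr}$ sends $(\Gamma,w,l)$ to its Jacobian, that is, the torus $(H_1(\Gamma,\mathbb R)\oplus\mathbb R^{|w|})/(H_1(\Gamma,\mathbb Z)\oplus\mathbb Z^{|w|})$ with the quadratic form that is zero on $\mathbb R^{|w|}$ and equal to $\sum_e\alpha_e e\mapsto\sum_e l(e)\alpha_e^2$ on $H_1(\Gamma,\mathbb R)$. A connected graph is called $3$-vertex-connected if removing any two (possibly equal) vertices together with all edges adjacent to them leaves a connected (possibly empty) graph. Let $F\subset M_g^{\rm tr}$ be the locus of tropical curves whose underlying graph $\Gamma$ is loopless, $3$-vertex-connected and of genus $g(\Gamma)=g$ (so all weights are zero). Then: 1. $t_g^{\rm tr}$ is injective on $F$; 2. $F$ is the union of finitely many strata of $M_g^{\rm tr}$, each of which is locally closed; 3. the subset of $F$ of the tropical curves whose underlying graph has no parallel edges is locally closed in $M_g^{\rm tr}$. -/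

import Mathlib

namespace TropicalTorelli

/-- A finite graph, possibly with loops and parallel edges. Every edge carries an auxiliary
reference orientation (from `src` to `tgt`), which is used only to write down the boundary map;
isomorphisms of graphs are not required to respect it. -/
structure Multigraph where
  V : Type
  E : Type
  [fintypeV : Fintype V]
  [fintypeE : Fintype E]
  src : E → V
  tgt : E → V

attribute [instance] Multigraph.fintypeV Multigraph.fintypeE

namespace Multigraph

variable (G : Multigraph)

/-- The unordered pair of end vertices of an edge. -/
def ends (e : G.E) : Sym2 G.V := s(G.src e, G.tgt e)

/-- The adjacency relation on the vertices given by the edges in `S` (loops are discarded and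
multiplicities forgotten): it records which vertices are connected through `S`. -/
def adjVia (S : Set G.E) : SimpleGraph G.V := SimpleGraph.fromEdgeSet (G.ends '' S)

theorem adjVia_adj (S : Set G.E) (u v : G.V) :
    (G.adjVia S).Adj u v ↔ (∃ e ∈ S, G.ends e = s(u, v)) ∧ u ≠ v :=
  SimpleGraph.fromEdgeSet_adj _

/-- The graph is connected (in particular, non-empty). -/
def Connected : Prop := (G.adjVia Set.univ).Connected

/-- The valence of a vertex; a loop counts twice. -/
noncomputable def valence (v : G.V) : ℕ := Nat.card {e : G.E // G.src e = v} + Nat.card {e : G.E // G.tgt e = v}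

/-- The genus (first Betti number) `#E - #V + 1` of a connected graph. The subtraction is not
truncated, since a connected graph has at most `#E + 1` vertices. -/
noncomputable def genus : ℕ := Nat.card G.E + 1 - Nat.card G.V

/-- No edge is a loop. -/
def Loopless : Prop := ∀ e : G.E, G.src e ≠ G.tgt e

/-- No loops and no parallel edges. -/
def Simple : Prop := G.Loopless ∧ Function.Injective G.ends

/-- The graph is connected and, for any two possibly equal vertices, it remains connected after
removing them together with all edges adjacent to them. When nothing is left after the removal,
the condition is regarded as satisfied. -/
def ThreeVertexConnected : Prop :=
  G.Connected ∧ ∀ v₁ v₂ : G.V, ((G.adjVia Set.univ).induce ({v₁, v₂}ᶜ : Set G.V)).Preconnected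

open Classical in
/-- The boundary map `∂ : C₁(Γ, R) → C₀(Γ, R)`, `∂ e = tgt e - src e`. -/
noncomputable def boundary (R : Type*) [CommRing R] : (G.E → R) →ₗ[R] (G.V → R) :=
  Fintype.linearCombination R
    (fun e => (Pi.single (G.tgt e) 1 - Pi.single (G.src e) 1 : G.V → R))

/-- The first homology group `H₁(Γ, R)`, the kernel of the boundary map. -/
noncomputable abbrev H1 (R : Type*) [CommRing R] : Submodule R (G.E → R) :=
  LinearMap.ker (G.boundary R)

end Multigraph

/-- A graph with a weight function on its vertices. -/
structure WeightedGraph extends Multigraph where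
  w : V → ℕ

namespace WeightedGraph

variable (G : WeightedGraph)

/-- The total weight `|w|`. -/
def totalWeight : ℕ := ∑ v, G.w v

/-- The genus `g(Γ) + |w|`. -/
noncomputable def wgenus : ℕ := G.genus + G.totalWeight

/-- Every vertex of weight zero has valence at least three. -/
def Stable : Prop := ∀ v, G.w v = 0 → 3 ≤ G.valence v

/-- The contraction of a set `S` of edges. Its vertices are the connected components of the
subgraph `(V, S)`, its edges are the edges outside `S`, and the weight of a component is the sum of
the weights of its vertices plus its first Betti number (the subtraction is never truncated, by
`card_comp_le` below). This is the result of contracting the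
edges in `S` one after the other, where contracting an edge between two distinct vertices adds
their weights, and contracting a loop increases the weight of its vertex by one. -/
noncomputable def contract (S : Set G.E) : WeightedGraph where
  V := (G.adjVia S).ConnectedComponent
  E := {e : G.E // e ∉ S}
  fintypeV := Fintype.ofFinite _
  fintypeE := Fintype.ofFinite _
  src e := (G.adjVia S).connectedComponentMk (G.src e)
  tgt e := (G.adjVia S).connectedComponentMk (G.tgt e)
  w c := (∑ᶠ v : {v : G.V // (G.adjVia S).connectedComponentMk v = c}, G.w v) +
    (Nat.card {e : G.E // e ∈ S ∧ (G.adjVia S).connectedComponentMk (G.src e) = c} + 1 -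
      Nat.card {v : G.V // (G.adjVia S).connectedComponentMk v = c})

/-- The component containing a vertex. -/
abbrev comp (S : Set G.E) (v : G.V) : (G.adjVia S).ConnectedComponent :=
  (G.adjVia S).connectedComponentMk v

theorem comp_src_eq_comp_tgt (S : Set G.E) {e : G.E} (he : e ∈ S) :
    G.comp S (G.src e) = G.comp S (G.tgt e) := by
  by_cases h : G.src e = G.tgt e
  · rw [h]
  · apply SimpleGraph.ConnectedComponent.sound
    apply SimpleGraph.Adj.reachable
    exact (G.adjVia_adj S _ _).2 ⟨⟨e, he, rfl⟩, h⟩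

theorem card_comp_le (S : Set G.E) (c : (G.adjVia S).ConnectedComponent) :
    Nat.card {v : G.V // G.comp S v = c} ≤
      Nat.card {e : G.E // e ∈ S ∧ G.comp S (G.src e) = c} + 1 := by
  have h1 := (c.connected_toSimpleGraph).card_vert_le_card_edgeSet_add_one
  have h2 : Nat.card c.toSimpleGraph.edgeSet ≤
      Nat.card {e : G.E // e ∈ S ∧ G.comp S (G.src e) = c} := by
    have key : ∀ x : c.toSimpleGraph.edgeSet,
        ∃ e : {e : G.E // e ∈ S ∧ G.comp S (G.src e) = c},
          G.ends e = (x : Sym2 c).map Subtype.val := by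
      rintro ⟨x, hx⟩
      induction x using Sym2.ind with
      | _ a b =>
        have hab : (G.adjVia S).Adj a.1 b.1 := hx
        have hab' := hab
        rw [Multigraph.adjVia_adj] at hab'
        obtain ⟨⟨e, he, hee⟩, hne⟩ := hab'
        refine ⟨⟨e, he, ?_⟩, by simpa using hee⟩
        have ha : G.comp S a.1 = c := a.2
        have hb : G.comp S b.1 = c := b.2
        rw [Multigraph.ends, Sym2.eq_iff] at hee
        rcases hee with h | h
        · rw [h.1, ha]
        · rw [h.1, hb]
    choose f hf using key
    apply Nat.card_le_card_of_injective f
    intro x y hxy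
    have : (x : Sym2 c).map Subtype.val = (y : Sym2 c).map Subtype.val := by
      rw [← hf, ← hf, hxy]
    exact Subtype.ext (Sym2.map.injective Subtype.val_injective this)
  exact h1.trans (Nat.add_le_add_right h2 1)

theorem contract_connected (S : Set G.E) (h : G.toMultigraph.Connected) :
    (G.contract S).toMultigraph.Connected := by
  let q : G.V → (G.contract S).V := G.comp S
  have hmap : ∀ u v : G.V, (G.adjVia Set.univ).Reachable u v →
      ((G.contract S).adjVia Set.univ).Reachable (q u) (q v) := by
    rintro u v ⟨p⟩
    induction p with
    | nil => exact SimpleGraph.Reachable.refl _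
    | @cons a b d hab _ ih =>
      refine SimpleGraph.Reachable.trans ?_ ih
      by_cases hc : q a = q b
      · rw [hc]
      · apply SimpleGraph.Adj.reachable
        rw [Multigraph.adjVia_adj] at hab ⊢
        obtain ⟨⟨e, -, hee⟩, -⟩ := hab
        refine ⟨?_, hc⟩
        have heS : e ∉ S := by
          intro heS
          have : q (G.src e) = q (G.tgt e) := G.comp_src_eq_comp_tgt S heS
          rw [Multigraph.ends, Sym2.eq_iff] at hee
          rcases hee with h | h
          · rw [h.1, h.2] at this; exact hc this
          · rw [h.1, h.2] at this; exact hc this.symm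
        refine ⟨⟨e, heS⟩, trivial, ?_⟩
        have : Sym2.map q (G.ends e) = s(q a, q b) := by
          rw [hee]; rfl
        exact this
  obtain ⟨v⟩ := h.nonempty
  have : Nonempty (G.contract S).V := ⟨q v⟩
  refine SimpleGraph.Connected.mk ?_
  intro c d
  obtain ⟨a, rfl⟩ : ∃ a, q a = c := Quot.exists_rep c
  obtain ⟨b, rfl⟩ : ∃ b, q b = d := Quot.exists_rep d
  exact hmap a b (h.preconnected a b)

theorem sum_card_fiber {X Y : Type} [Fintype X] [Fintype Y] (f : X → Y) :
    ∑ y, Nat.card {x // f x = y} = Nat.card X := by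
  rw [← Nat.card_sigma, Nat.card_congr (Equiv.sigmaFiberEquiv f)]

theorem card_compl (S : Set G.E) : Nat.card {e // e ∈ S} + Nat.card {e // e ∉ S} = Nat.card G.E := by
  classical
  rw [← Nat.card_sum, Nat.card_congr (Equiv.sumCompl _)]

theorem card_split {X : Type} [Fintype X] (S : Set X) (p : X → Prop) :
    Nat.card {x // p x} = Nat.card {x // x ∈ S ∧ p x} + Nat.card {x : {x // x ∉ S} // p x.1} := by
  classical
  rw [← Nat.card_sum]
  refine Nat.card_congr ?_
  refine (Equiv.sumCompl (fun x : {x // p x} => x.1 ∈ S)).symm.trans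
    (Equiv.sumCongr ?_ ?_)
  · exact (Equiv.subtypeSubtypeEquivSubtypeInter p (· ∈ S)).trans
      (Equiv.subtypeEquivRight fun x => and_comm)
  · exact (Equiv.subtypeSubtypeEquivSubtypeInter p (· ∉ S)).trans
      ((Equiv.subtypeEquivRight fun x => and_comm).trans
        (Equiv.subtypeSubtypeEquivSubtypeInter (· ∉ S) p).symm)

theorem contract_wgenus (S : Set G.E) (h : G.toMultigraph.Connected) :
    (G.contract S).wgenus = G.wgenus := by
  classical
  let _ : Fintype (G.adjVia S).ConnectedComponent := Fintype.ofFinite _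
  have e1 : ∑ c, Nat.card {v : G.V // G.comp S v = c} = Nat.card G.V := sum_card_fiber (G.comp S)
  have e2 : ∑ c, Nat.card {e : G.E // e ∈ S ∧ G.comp S (G.src e) = c} = Nat.card {e // e ∈ S} := by
    rw [← sum_card_fiber (fun e : {e // e ∈ S} => G.comp S (G.src e.1))]
    refine Finset.sum_congr rfl fun c _ => Nat.card_congr ?_
    exact (Equiv.subtypeSubtypeEquivSubtypeInter (· ∈ S) (fun e => G.comp S (G.src e) = c)).symm
  have e3 : ∑ c, ∑ᶠ v : {v : G.V // G.comp S v = c}, G.w v = G.totalWeight := by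
    rw [WeightedGraph.totalWeight, ← Equiv.sum_comp (Equiv.sigmaFiberEquiv (G.comp S)),
      Fintype.sum_sigma]
    refine Finset.sum_congr rfl fun c _ => ?_
    rw [finsum_eq_sum_of_fintype]
    rfl
  have e4 := G.card_compl S
  have e5 : (G.contract S).totalWeight + Nat.card G.V =
      G.totalWeight + Nat.card {e // e ∈ S} +
        Nat.card (G.adjVia S).ConnectedComponent := by
    have hw : (G.contract S).totalWeight = ∑ c : (G.adjVia S).ConnectedComponent,
        ((∑ᶠ v : {v : G.V // G.comp S v = c}, G.w v) +
      (Nat.card {e : G.E // e ∈ S ∧ G.comp S (G.src e) = c} + 1 -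
      Nat.card {v : G.V // G.comp S v = c})) := rfl
    rw [hw, ← e1, ← e2, ← e3, Nat.card_eq_fintype_card, Fintype.card_eq_sum_ones,
      ← Finset.sum_add_distrib, ← Finset.sum_add_distrib, ← Finset.sum_add_distrib]
    refine Finset.sum_congr rfl fun c _ => ?_
    have := G.card_comp_le S c
    omega
  have b1 : ∀ H : Multigraph, H.Connected → Nat.card H.V ≤ Nat.card H.E + 1 := by
    intro H hH
    have h1 := SimpleGraph.Connected.card_vert_le_card_edgeSet_add_one hH
    have h2 : Nat.card (H.adjVia Set.univ).edgeSet ≤ Nat.card H.E := by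
      have : ∀ x : (H.adjVia Set.univ).edgeSet, ∃ e, H.ends e = x := by
        rintro ⟨x, hx⟩
        rw [Multigraph.adjVia, SimpleGraph.edgeSet_fromEdgeSet] at hx
        obtain ⟨⟨e, -, he⟩, -⟩ := hx
        exact ⟨e, he⟩
      choose f hf using this
      refine Nat.card_le_card_of_injective f fun x y hxy => Subtype.ext ?_
      rw [← hf, ← hf, hxy]
    omega
  have b2 := b1 _ h
  have b3 : Nat.card (G.adjVia S).ConnectedComponent ≤ Nat.card {e // e ∉ S} + 1 :=
    b1 _ (G.contract_connected S h)
  have g1 : (G.contract S).genus = Nat.card {e // e ∉ S} + 1 -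
    Nat.card (G.adjVia S).ConnectedComponent := rfl
  have g2 : G.genus = Nat.card G.E + 1 - Nat.card G.V := rfl
  rw [wgenus, wgenus, g1, g2]
  omega

theorem contract_stable (S : Set G.E) (h : G.Stable) : (G.contract S).Stable := by
  classical
  intro c hc
  change (G.adjVia S).ConnectedComponent at c
  have hc' : (∑ᶠ v : {v : G.V // G.comp S v = c}, G.w v) +
      (Nat.card {e : G.E // e ∈ S ∧ G.comp S (G.src e) = c} + 1 -
      Nat.card {v : G.V // G.comp S v = c}) = 0 := hc
  obtain ⟨h0, h1⟩ := Nat.add_eq_zero_iff.1 hc'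
  have hw : ∀ v : {v : G.V // G.comp S v = c}, G.w v = 0 := by
    rw [finsum_eq_sum_of_fintype] at h0
    intro v
    exact (Finset.sum_eq_zero_iff.1 h0) v (Finset.mem_univ v)
  have hsum : ∑ v : {v : G.V // G.comp S v = c}, 3 ≤
      ∑ v : {v : G.V // G.comp S v = c}, G.valence v :=
    Finset.sum_le_sum fun v _ => h v (hw v)
  have hval : ∀ f : G.E → G.V, ∑ v : {v : G.V // G.comp S v = c}, Nat.card {e // f e = v} =
      Nat.card {e : G.E // G.comp S (f e) = c} := by
    intro f
    rw [← sum_card_fiber (fun e : {e : G.E // G.comp S (f e) = c} =>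
      (⟨f e.1, e.2⟩ : {v : G.V // G.comp S v = c}))]
    refine Finset.sum_congr rfl fun v _ => Nat.card_congr ?_
    refine ⟨fun e => ⟨⟨e.1, by rw [e.2]; exact v.2⟩, Subtype.ext e.2⟩,
      fun e => ⟨e.1.1, congrArg Subtype.val e.2⟩, fun _ => rfl, fun _ => rfl⟩
  simp only [Multigraph.valence, Finset.sum_add_distrib] at hsum
  rw [hval, hval, card_split S (fun e => G.comp S (G.src e) = c),
    card_split S (fun e => G.comp S (G.tgt e) = c)] at hsum
  have hst : Nat.card {e : G.E // e ∈ S ∧ G.comp S (G.tgt e) = c} =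
      Nat.card {e : G.E // e ∈ S ∧ G.comp S (G.src e) = c} := by
    refine Nat.card_congr (Equiv.subtypeEquivRight fun e => ?_)
    refine and_congr_right fun he => ?_
    rw [G.comp_src_eq_comp_tgt S he]
  have hv : (G.contract S).valence c =
      Nat.card {e : {e : G.E // e ∉ S} // G.comp S (G.src e.1) = c} +
      Nat.card {e : {e : G.E // e ∉ S} // G.comp S (G.tgt e.1) = c} := rfl
  have h3 : ∑ v : {v : G.V // G.comp S v = c}, 3 = Nat.card {v : G.V // G.comp S v = c} * 3 := by
    simp
  have hpos : 0 < Nat.card {v : G.V // G.comp S v = c} := by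
    have : Nonempty {v : G.V // G.comp S v = c} := by
      induction c using SimpleGraph.ConnectedComponent.ind with
      | _ v => exact ⟨⟨v, rfl⟩⟩
    exact Nat.card_pos
  rw [hv]
  omega

end WeightedGraph

/-- A stable weighted (connected) graph of genus `g`. -/
structure StableGraph (g : ℕ) extends WeightedGraph where
  connected : toMultigraph.Connected
  stable : toWeightedGraph.Stable
  wgenus_eq : toWeightedGraph.wgenus = g

/-- A tropical curve `(Γ, w, l)` of genus `g`. -/
structure TropicalCurve (g : ℕ) extends StableGraph g where
  l : E → ℝ
  l_pos : ∀ e, 0 < l e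

/-- Two tropical curves are isomorphic if there are bijections of the vertices and of the edges
preserving end vertices, weights and lengths. -/
def TropicalCurve.Iso {g : ℕ} (C C' : TropicalCurve g) : Prop :=
  ∃ (σ : C.V ≃ C'.V) (ψ : C.E ≃ C'.E),
    (∀ e, C'.ends (ψ e) = (C.ends e).map σ) ∧
    (∀ v, C'.w (σ v) = C.w v) ∧
    (∀ e, C'.l (ψ e) = C.l e)

theorem TropicalCurve.iso_equivalence (g : ℕ) : Equivalence (TropicalCurve.Iso (g := g)) where
  refl C := ⟨Equiv.refl _, Equiv.refl _, by simp, by simp, by simp⟩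
  symm := by
    rintro C C' ⟨σ, ψ, h1, h2, h3⟩
    refine ⟨σ.symm, ψ.symm, fun e => ?_, fun v => ?_, fun e => ?_⟩
    · have := h1 (ψ.symm e)
      rw [Equiv.apply_symm_apply] at this
      rw [this, Sym2.map_map]
      simp
    · simpa using (h2 (σ.symm v)).symm
    · simpa using (h3 (ψ.symm e)).symm
  trans := by
    rintro C C' C'' ⟨σ, ψ, h1, h2, h3⟩ ⟨σ', ψ', h1', h2', h3'⟩
    refine ⟨σ.trans σ', ψ.trans ψ', fun e => ?_, fun v => ?_, fun e => ?_⟩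
    · simp [h1', h1, Sym2.map_map]
    · simp [h2', h2]
    · simp [h3', h3]

/-- Isomorphism of tropical curves as a setoid. -/
def TropicalCurve.setoid (g : ℕ) : Setoid (TropicalCurve g) :=
  ⟨TropicalCurve.Iso, TropicalCurve.iso_equivalence g⟩

/-- The set of points of the moduli space `M_g^tr`: isomorphism classes of tropical curves of
genus `g`. -/
def Mtr (g : ℕ) : Type 1 := Quotient (TropicalCurve.setoid g)

/-- The isomorphism class of a tropical curve. -/
def TropicalCurve.toMtr {g : ℕ} (C : TropicalCurve g) : Mtr g :=
  Quotient.mk (TropicalCurve.setoid g) C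


open scoped NNReal

/-- The tropical curve given by a point of the closed cone `ℝ_{≥0}^{E(Γ)}` of a stable weighted
graph: contract all the edges of length zero and keep the lengths of the other edges. -/
noncomputable def StableGraph.curveOf {g : ℕ} (G : StableGraph g) (l : G.E → ℝ≥0) :
    TropicalCurve g where
  toWeightedGraph := G.contract {e | l e = 0}
  connected := G.contract_connected _ G.connected
  stable := G.contract_stable _ G.stable
  wgenus_eq := (G.contract_wgenus _ G.connected).trans G.wgenus_eq
  l e := l e.1
  l_pos e := NNReal.coe_pos.2 (pos_iff_ne_zero.2 e.2)

/-- The topology of `M_g^tr`, obtained by gluing the closed cones `ℝ_{≥0}^{E(Γ)}` of all the stable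
weighted graphs of genus `g`: a subset is open if and only if its preimage in each of these cones
is open. -/
noncomputable instance (g : ℕ) : TopologicalSpace (Mtr g) :=
  ⨆ G : StableGraph g, TopologicalSpace.coinduced (fun l => (G.curveOf l).toMtr) inferInstance

/-- The stratum `M_g^tr(Γ, w)` of all tropical curves of combinatorial type `(Γ, w)`. -/
def stratum {g : ℕ} (G : StableGraph g) : Set (Mtr g) :=
  {x | ∃ (l : G.E → ℝ) (hl : ∀ e, 0 < l e), x = TropicalCurve.toMtr ⟨G, l, hl⟩}

/-- A tropical principally polarized abelian variety of dimension `g`: a real torus `W / Λ`, given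
by a `g`-dimensional real vector space `W` and a lattice `Λ` in it (the integral span of a basis
of `W`), together with a positive semi-definite quadratic form on `W` whose null space is spanned
by lattice vectors. -/
structure TropicalPPAV (g : ℕ) where
  W : Type
  [addCommGroup : AddCommGroup W]
  [module : Module ℝ W]
  Λ : Submodule ℤ W
  Q : QuadraticForm ℝ W
  lattice : ∃ b : Module.Basis (Fin g) ℝ W, Submodule.span ℤ (Set.range b) = Λ
  nonneg : ∀ x, 0 ≤ Q x
  null_rational : ∃ s ⊆ (Λ : Set W), (Submodule.span ℝ s : Set W) = {x | Q x = 0}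

attribute [instance] TropicalPPAV.addCommGroup TropicalPPAV.module

/-- Two tropical p.p. abelian varieties are isomorphic if there is a linear isomorphism which
identifies the lattices and the quadratic forms. -/
def TropicalPPAV.Iso {g : ℕ} (A A' : TropicalPPAV g) : Prop :=
  ∃ h : A.W ≃ₗ[ℝ] A'.W, (∀ x, h x ∈ A'.Λ ↔ x ∈ A.Λ) ∧ ∀ x, A'.Q (h x) = A.Q x

theorem TropicalPPAV.iso_equivalence (g : ℕ) : Equivalence (TropicalPPAV.Iso (g := g)) where
  refl A := ⟨LinearEquiv.refl ℝ A.W, fun _ => Iff.rfl, fun _ => rfl⟩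
  symm := by
    rintro A A' ⟨h, h1, h2⟩
    refine ⟨h.symm, fun x => ?_, fun x => ?_⟩
    · simpa using (h1 (h.symm x)).symm
    · simpa using (h2 (h.symm x)).symm
  trans := by
    rintro A A' A'' ⟨h, h1, h2⟩ ⟨k, k1, k2⟩
    exact ⟨h.trans k, fun x => (k1 _).trans (h1 x), fun x => (k2 _).trans (h2 x)⟩

/-- Isomorphism of tropical p.p. abelian varieties as a setoid. -/
def TropicalPPAV.setoid (g : ℕ) : Setoid (TropicalPPAV g) :=
  ⟨TropicalPPAV.Iso, TropicalPPAV.iso_equivalence g⟩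

/-- The set of points of the moduli space `A_g^tr`: isomorphism classes of tropical p.p. abelian
varieties of dimension `g`. -/
def Atr (g : ℕ) : Type 1 := Quotient (TropicalPPAV.setoid g)

/-- The isomorphism class of a tropical p.p. abelian variety. -/
def TropicalPPAV.toAtr {g : ℕ} (A : TropicalPPAV g) : Atr g :=
  Quotient.mk (TropicalPPAV.setoid g) A

namespace Multigraph

variable (G : Multigraph)

open Classical in
theorem boundary_apply (R : Type*) [CommRing R] (f : G.E → R) (v : G.V) :
    G.boundary R f v =
      ∑ e, f e * ((if G.tgt e = v then 1 else 0) - (if G.src e = v then 1 else 0)) := by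
  rw [boundary, Fintype.linearCombination_apply, Finset.sum_apply]
  refine Finset.sum_congr rfl fun e _ => ?_
  simp [Pi.single_apply, eq_comm]

theorem finrank_H1 (h : G.Connected) :
    Module.finrank ℝ (G.H1 ℝ) = G.genus := by
  classical
  obtain ⟨v0⟩ := h.nonempty
  let δ : G.V → G.V → ℝ := fun v => Pi.single v 1
  let aug : (G.V → ℝ) →ₗ[ℝ] ℝ := ∑ v, LinearMap.proj v
  have haug : ∀ f, aug f = ∑ v, f v := fun f => by simp [aug]
  have hb : ∀ e, G.boundary ℝ (Pi.single e 1) = δ (G.tgt e) - δ (G.src e) := by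
    intro e
    simp [boundary, δ, Fintype.linearCombination_apply_single]
  have hreach : ∀ u v, (G.adjVia Set.univ).Reachable u v →
      δ v - δ u ∈ LinearMap.range (G.boundary ℝ) := by
    rintro u v ⟨p⟩
    induction p with
    | nil => simp
    | @cons a b d hab _ ih =>
      rw [adjVia_adj] at hab
      obtain ⟨⟨e, -, hee⟩, -⟩ := hab
      have : δ b - δ a ∈ LinearMap.range (G.boundary ℝ) := by
        rw [ends, Sym2.eq_iff] at hee
        rcases hee with h | h
        · rw [← h.1, ← h.2, ← hb]; exact LinearMap.mem_range_self _ _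
        · rw [← h.1, ← h.2, ← neg_sub, ← hb]
          exact Submodule.neg_mem _ (LinearMap.mem_range_self _ _)
      have h2 := Submodule.add_mem _ ih this
      simpa using h2
  have hrange : LinearMap.range (G.boundary ℝ) = LinearMap.ker aug := by
    apply le_antisymm
    · rintro _ ⟨f, rfl⟩
      rw [LinearMap.mem_ker, boundary, Fintype.linearCombination_apply, map_sum]
      refine Finset.sum_eq_zero fun e _ => ?_
      rw [map_smul, map_sub, haug, haug]
      simp
    · intro f hf
      rw [LinearMap.mem_ker, haug] at hf
      have : f = ∑ v, f v • (δ v - δ v0) := by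
        simp_rw [smul_sub, Finset.sum_sub_distrib, ← Finset.sum_smul, hf, zero_smul, sub_zero]
        ext w
        simp [δ, Finset.sum_apply, Pi.single_apply]
      rw [this]
      exact Submodule.sum_mem _ fun v _ =>
        Submodule.smul_mem _ _ (hreach v0 v (h.preconnected v0 v))
  have hsurj : LinearMap.range aug = ⊤ := by
    rw [LinearMap.range_eq_top]
    intro r
    refine ⟨Pi.single v0 r, ?_⟩
    rw [haug]; simp
  have r1 := LinearMap.finrank_range_add_finrank_ker aug
  have r2 := LinearMap.finrank_range_add_finrank_ker (G.boundary ℝ)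
  rw [hrange] at r2
  rw [hsurj] at r1
  simp only [finrank_top, Module.finrank_self, Module.finrank_fintype_fun_eq_card] at r1 r2
  rw [genus, Nat.card_eq_fintype_card, Nat.card_eq_fintype_card]
  change Module.finrank ℝ (LinearMap.ker (G.boundary ℝ)) = _
  omega

/-- Every real cycle is a real linear combination of integral cycles. -/
theorem mem_span_integral (x : G.E → ℝ) (hx : x ∈ G.H1 ℝ) :
    x ∈ Submodule.span ℝ ((fun k : G.E → ℤ => fun e => (k e : ℝ)) '' (G.H1 ℤ : Set (G.E → ℤ))) := by
  classical
  let pE := TensorProduct.piScalarRight ℤ ℝ ℝ G.E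
  let pV := TensorProduct.piScalarRight ℤ ℝ ℝ G.V
  have hex := Module.Flat.lTensor_exact (R := ℤ) ℝ
    (LinearMap.exact_subtype_ker_map (G.boundary ℤ))
  have hcomm : ∀ t, pV ((G.boundary ℤ).lTensor ℝ t) = G.boundary ℝ (pE t) := by
    intro t
    induction t using TensorProduct.induction_on with
    | zero => simp
    | add a b ha hb => simp only [map_add, ha, hb]
    | tmul r k =>
      ext v
      simp only [pE, pV, LinearMap.lTensor_tmul, TensorProduct.piScalarRight_apply,
        TensorProduct.piScalarRightHom_tmul, boundary_apply, zsmul_eq_mul]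
      push_cast
      rw [Finset.sum_mul]
      refine Finset.sum_congr rfl fun e _ => ?_
      ring
  have h0 : (G.boundary ℤ).lTensor ℝ (pE.symm x) = 0 := by
    apply pV.injective
    rw [hcomm, LinearEquiv.apply_symm_apply, map_zero]
    exact hx
  obtain ⟨y, hy⟩ := (hex _).1 h0
  have hxy : x = pE ((LinearMap.ker (G.boundary ℤ)).subtype.lTensor ℝ y) := by
    rw [hy, LinearEquiv.apply_symm_apply]
  rw [hxy]
  clear hxy hy h0
  induction y using TensorProduct.induction_on with
  | zero => simp
  | add a b ha hb =>
    rw [map_add, map_add]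
    exact Submodule.add_mem _ ha hb
  | tmul r k =>
    have : pE ((LinearMap.ker (G.boundary ℤ)).subtype.lTensor ℝ (r ⊗ₜ k)) =
        r • (fun e => ((k : G.E → ℤ) e : ℝ)) := by
      ext e
      simp [pE, mul_comm]
    rw [this]
    exact Submodule.smul_mem _ _ (Submodule.subset_span ⟨k, k.2, rfl⟩)

end Multigraph

namespace TropicalCurve

variable {g : ℕ} (C : TropicalCurve g)

/-- The real vector space `H₁(Γ, ℝ) ⊕ ℝ^|w|`. -/
abbrev JacSpace : Type := C.H1 ℝ × (Fin C.totalWeight → ℝ)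

/-- The lattice `H₁(Γ, ℤ) ⊕ ℤ^|w|` in `H₁(Γ, ℝ) ⊕ ℝ^|w|`; here `H₁(Γ, ℤ)` is the group of the
cycles with integral coefficients. -/
def jacLattice : Submodule ℤ C.JacSpace where
  carrier := {x | (∀ e, ∃ n : ℤ, (n : ℝ) = (x.1 : C.E → ℝ) e) ∧ ∀ i, ∃ n : ℤ, (n : ℝ) = x.2 i}
  zero_mem' := ⟨fun _ => ⟨0, by simp⟩, fun _ => ⟨0, by simp⟩⟩
  add_mem' := by
    rintro x y ⟨hx1, hx2⟩ ⟨hy1, hy2⟩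
    refine ⟨fun e => ?_, fun i => ?_⟩
    · obtain ⟨n, hn⟩ := hx1 e
      obtain ⟨m, hm⟩ := hy1 e
      exact ⟨n + m, by simp [hn, hm]⟩
    · obtain ⟨n, hn⟩ := hx2 i
      obtain ⟨m, hm⟩ := hy2 i
      exact ⟨n + m, by simp [hn, hm]⟩
  smul_mem' := by
    rintro k x ⟨hx1, hx2⟩
    refine ⟨fun e => ?_, fun i => ?_⟩
    · obtain ⟨n, hn⟩ := hx1 e
      exact ⟨k * n, by simp [hn]⟩
    · obtain ⟨n, hn⟩ := hx2 i
      exact ⟨k * n, by simp [hn]⟩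

/-- The quadratic form `Q_C (∑ α_e e) = ∑ l(e) α_e ^ 2` on `H₁(Γ, ℝ)`, extended by zero to
`H₁(Γ, ℝ) ⊕ ℝ^|w|`. -/
noncomputable def jacForm : QuadraticForm ℝ C.JacSpace :=
  (QuadraticMap.weightedSumSquares ℝ C.l).comp ((C.H1 ℝ).subtype ∘ₗ LinearMap.fst ℝ _ _)

theorem jacForm_apply (x : C.JacSpace) : C.jacForm x = ∑ e, C.l e * (x.1 : C.E → ℝ) e ^ 2 := by
  simp [jacForm, QuadraticMap.weightedSumSquares_apply, sq]

theorem jacForm_eq_zero (x : C.JacSpace) : C.jacForm x = 0 ↔ x.1 = 0 := by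
  rw [jacForm_apply, Finset.sum_eq_zero_iff_of_nonneg
    fun e _ => mul_nonneg (C.l_pos e).le (sq_nonneg _)]
  constructor
  · intro h
    ext e
    have := h e (Finset.mem_univ e)
    simpa [(C.l_pos e).ne'] using this
  · intro h e _
    simp [h]

theorem span_jacLattice : Submodule.span ℝ (C.jacLattice : Set C.JacSpace) = ⊤ := by
  classical
  rw [eq_top_iff]
  have h1 : ∀ y : C.E → ℝ, y ∈ Submodule.span ℝ
      ((fun k : C.E → ℤ => fun e => (k e : ℝ)) '' (C.H1 ℤ : Set (C.E → ℤ))) →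
      ∃ hy : y ∈ C.H1 ℝ, ((⟨y, hy⟩, 0) : C.JacSpace) ∈
        Submodule.span ℝ (C.jacLattice : Set C.JacSpace) := by
    intro y hy
    induction hy using Submodule.span_induction with
    | mem y hy =>
      obtain ⟨k, hk, rfl⟩ := hy
      have hk' : (fun e => (k e : ℝ)) ∈ C.H1 ℝ := by
        rw [LinearMap.mem_ker]
        ext v
        have h2 := congrFun (LinearMap.mem_ker.1 hk) v
        rw [Multigraph.boundary_apply] at h2 ⊢
        have h3 := congrArg (Int.cast (R := ℝ)) h2
        push_cast at h3
        simpa using h3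
      exact ⟨hk', Submodule.subset_span ⟨fun e => ⟨k e, rfl⟩, fun i => ⟨0, by simp⟩⟩⟩
    | zero => exact ⟨Submodule.zero_mem _, Submodule.zero_mem _⟩
    | add a b _ _ ha hb =>
      obtain ⟨ha, ha'⟩ := ha
      obtain ⟨hb, hb'⟩ := hb
      refine ⟨Submodule.add_mem _ ha hb, ?_⟩
      simpa using Submodule.add_mem _ ha' hb'
    | smul r a _ ha =>
      obtain ⟨ha, ha'⟩ := ha
      refine ⟨Submodule.smul_mem _ r ha, ?_⟩
      simpa using Submodule.smul_mem _ r ha'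
  rintro ⟨x, y⟩ -
  obtain ⟨_, h2⟩ := h1 x (C.mem_span_integral x x.2)
  have h3 : ((0, y) : C.JacSpace) ∈ Submodule.span ℝ (C.jacLattice : Set C.JacSpace) := by
    have : ((0, y) : C.JacSpace) = ∑ i, y i • ((0, Pi.single i 1) : C.JacSpace) := by
      refine Prod.ext ?_ ?_
      · simp [Prod.fst_sum]
      · simp only [Prod.snd_sum, Prod.smul_mk]
        exact pi_eq_sum_univ' y
    rw [this]
    refine Submodule.sum_mem _ fun i _ => Submodule.smul_mem _ _ (Submodule.subset_span ?_)
    refine ⟨fun e => ⟨0, by simp⟩, fun j => ?_⟩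
    by_cases h : j = i
    · subst h; exact ⟨1, by simp⟩
    · exact ⟨0, by simp [h]⟩
  simpa using Submodule.add_mem _ h2 h3

instance : DiscreteTopology C.jacLattice := by
  rw [discreteTopology_iff_isOpen_singleton_zero, Metric.isOpen_singleton_iff]
  refine ⟨1, one_pos, ?_⟩
  rintro ⟨x, hx1, hx2⟩ hd
  have hn : ‖x‖ < 1 := by simpa [dist_eq_norm] using hd
  have hint : ∀ r : ℝ, (∃ n : ℤ, (n : ℝ) = r) → ‖r‖ < 1 → r = 0 := by
    rintro _ ⟨n, rfl⟩ h
    rw [Real.norm_eq_abs, ← Int.cast_abs] at h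
    have : |n| < 1 := by exact_mod_cast h
    simpa using Int.abs_lt_one_iff.1 this
  apply Subtype.ext
  refine Prod.ext ?_ ?_
  · apply Subtype.ext
    ext e
    refine hint _ (hx1 e) (lt_of_le_of_lt ?_ hn)
    exact (norm_le_pi_norm (x.1 : C.E → ℝ) e).trans (norm_fst_le x)
  · ext i
    refine hint _ (hx2 i) (lt_of_le_of_lt ?_ hn)
    exact (norm_le_pi_norm x.2 i).trans (norm_snd_le x)

theorem exists_basis_jacLattice :
    ∃ b : Module.Basis (Fin g) ℝ C.JacSpace, Submodule.span ℤ (Set.range b) = C.jacLattice := by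
  have hz : IsZLattice ℝ C.jacLattice := ⟨C.span_jacLattice⟩
  have hfree : Module.Free ℤ C.jacLattice := ZLattice.module_free ℝ _
  have hfin : Module.Finite ℤ C.jacLattice := ZLattice.module_finite ℝ _
  have hrank : Module.finrank ℤ C.jacLattice = g := by
    rw [ZLattice.rank ℝ, Module.finrank_prod, C.finrank_H1 C.connected]
    simpa [WeightedGraph.wgenus] using C.wgenus_eq
  exact ⟨(Module.finBasisOfFinrankEq ℤ C.jacLattice hrank).ofZLatticeBasis ℝ C.jacLattice,
    Module.Basis.ofZLatticeBasis_span _ _ _⟩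

/-- The Jacobian of a tropical curve. -/
noncomputable def Jac : TropicalPPAV g where
  W := C.JacSpace
  Λ := C.jacLattice
  Q := C.jacForm
  lattice := C.exists_basis_jacLattice
  nonneg x := by
    rw [jacForm_apply]
    exact Finset.sum_nonneg fun e _ => mul_nonneg (C.l_pos e).le (sq_nonneg _)
  null_rational := by
    classical
    refine ⟨Set.range fun i => (0, Pi.single i 1), ?_, ?_⟩
    · rintro _ ⟨i, rfl⟩
      refine ⟨fun e => ⟨0, by simp⟩, fun j => ?_⟩
      by_cases h : j = i
      · subst h; exact ⟨1, by simp⟩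
      · exact ⟨0, by simp [h]⟩
    · ext x
      change x ∈ Submodule.span ℝ _ ↔ C.jacForm x = 0
      rw [jacForm_eq_zero]
      constructor
      · intro hx
        induction hx using Submodule.span_induction with
        | mem y hy => obtain ⟨i, rfl⟩ := hy; rfl
        | zero => rfl
        | add a b _ _ ha hb => rw [Prod.fst_add, ha, hb, add_zero]
        | smul r a _ ha => rw [Prod.smul_fst, ha, smul_zero]
      · intro hx
        have : x = ∑ i, x.2 i • ((0, Pi.single i 1) : C.JacSpace) := by
          refine Prod.ext ?_ ?_
          · simp [Prod.fst_sum, hx]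
          · simp only [Prod.snd_sum, Prod.smul_mk]
            exact pi_eq_sum_univ' x.2
        rw [this]
        exact Submodule.sum_mem _ fun i _ =>
          Submodule.smul_mem _ _ (Submodule.subset_span ⟨i, rfl⟩)

theorem Iso.jac {C C' : TropicalCurve g} (h : C.Iso C') : C.Jac.Iso C'.Jac := by
  classical
  obtain ⟨σ, ψ, h1, h2, h3⟩ := h
  have hw : C.totalWeight = C'.totalWeight := by
    rw [WeightedGraph.totalWeight, WeightedGraph.totalWeight, ← Equiv.sum_comp σ]
    exact Finset.sum_congr rfl fun v _ => (h2 v).symm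
  let ε : C.E → ℝ := fun e => if C'.src (ψ e) = σ (C.src e) then 1 else -1
  have hε : ∀ e, ε e * ε e = 1 := fun e => by
    by_cases h : C'.src (ψ e) = σ (C.src e) <;> simp [ε, h]
  let T : (C.E → ℝ) ≃ₗ[ℝ] (C'.E → ℝ) :=
    { toFun := fun f e' => ε (ψ.symm e') * f (ψ.symm e')
      invFun := fun f e => ε e * f (ψ e)
      map_add' := fun a b => by ext; simp [mul_add]
      map_smul' := fun r a => by ext; simp [mul_left_comm]
      left_inv := fun f => by ext e; simp [← mul_assoc, hε]
      right_inv := fun f => by ext e; simp [← mul_assoc, hε] }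
  have hT : ∀ f e, T f (ψ e) = ε e * f e := fun f e => by simp [T]
  have hbd : ∀ f v, C'.boundary ℝ (T f) (σ v) = C.boundary ℝ f v := by
    intro f v
    rw [Multigraph.boundary_apply, Multigraph.boundary_apply, ← Equiv.sum_comp ψ]
    refine Finset.sum_congr rfl fun e _ => ?_
    rw [hT]
    have he : s(C'.src (ψ e), C'.tgt (ψ e)) = s(σ (C.src e), σ (C.tgt e)) := h1 e
    rw [Sym2.eq_iff] at he
    by_cases hs : C'.src (ψ e) = σ (C.src e)
    · have ht : C'.tgt (ψ e) = σ (C.tgt e) := by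
        rcases he with h | h
        · exact h.2
        · rw [h.2, ← hs, h.1]
      simp [ε, hs, ht]
    · have hst : C'.src (ψ e) = σ (C.tgt e) ∧ C'.tgt (ψ e) = σ (C.src e) :=
        he.resolve_left fun h => hs h.1
      have hne : ε e = -1 := by simp only [ε]; rw [if_neg hs]
      rw [hne, hst.1, hst.2]
      simp only [EmbeddingLike.apply_eq_iff_eq]
      ring
  have hker : (C.H1 ℝ).map (T : (C.E → ℝ) →ₗ[ℝ] (C'.E → ℝ)) = C'.H1 ℝ := by
    have hiff : ∀ f, T f ∈ C'.H1 ℝ ↔ f ∈ C.H1 ℝ := by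
      intro f
      rw [LinearMap.mem_ker, LinearMap.mem_ker, funext_iff, funext_iff,
        ← Equiv.forall_congr_right σ]
      simp only [hbd, Pi.zero_apply]
    ext f
    rw [Submodule.mem_map]
    constructor
    · rintro ⟨k, hk, rfl⟩
      exact (hiff k).2 hk
    · intro hf
      exact ⟨T.symm f, (hiff _).1 (by simpa using hf), by simp⟩
  let T1 : C.H1 ℝ ≃ₗ[ℝ] C'.H1 ℝ := (T.submoduleMap (C.H1 ℝ)).trans (LinearEquiv.ofEq _ _ hker)
  have hT1 : ∀ x, (T1 x : C'.E → ℝ) = T x := fun x => rfl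
  let T2 : (Fin C.totalWeight → ℝ) ≃ₗ[ℝ] (Fin C'.totalWeight → ℝ) :=
    LinearEquiv.funCongrLeft ℝ ℝ (finCongr hw.symm)
  let T3 : C.JacSpace ≃ₗ[ℝ] C'.JacSpace := T1.prodCongr T2
  have hT3 : ∀ (x : C.JacSpace) e, ((T3 x).1 : C'.E → ℝ) (ψ e) = ε e * (x.1 : C.E → ℝ) e :=
    fun x e => hT _ e
  have hT3' : ∀ (x : C.JacSpace) i, (T3 x).2 (finCongr hw i) = x.2 i := fun x i => rfl
  have hlat : ∀ x : C.JacSpace, T3 x ∈ C'.jacLattice ↔ x ∈ C.jacLattice := by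
    intro x
    refine and_congr ?_ ?_
    · rw [← Equiv.forall_congr_right ψ]
      refine forall_congr' fun e => ?_
      rw [hT3]
      have hε' : ε e = 1 ∨ ε e = -1 := by
        by_cases h : C'.src (ψ e) = σ (C.src e) <;> simp [ε, h]
      rcases hε' with h | h
      · rw [h, one_mul]
      · rw [h]
        constructor
        · rintro ⟨n, hn⟩; exact ⟨-n, by push_cast; linarith⟩
        · rintro ⟨n, hn⟩; exact ⟨-n, by push_cast; linarith⟩
    · rw [← Equiv.forall_congr_right (finCongr hw)]
      simp only [hT3']
  have hform : ∀ x : C.JacSpace, C'.jacForm (T3 x) = C.jacForm x := by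
    intro x
    rw [jacForm_apply, jacForm_apply, ← Equiv.sum_comp ψ]
    refine Finset.sum_congr rfl fun e _ => ?_
    rw [hT3, h3, mul_pow, sq (ε e), hε, one_mul]
  exact ⟨T3, hlat, hform⟩

end TropicalCurve

/-- The tropical Torelli map `t_g^tr : M_g^tr → A_g^tr`, sending a tropical curve to its
Jacobian. -/
noncomputable def torelli (g : ℕ) : Mtr g → Atr g :=
  Quotient.lift (fun C : TropicalCurve g => C.Jac.toAtr) fun _ _ h => Quotient.sound h.jac

/-- The locus of the tropical curves whose combinatorial type `(Γ, w)` is such that `Γ` is loopless,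
`3`-vertex-connected and of genus `g` (equivalently, all weights are zero). -/
def threeConnectedLocus (g : ℕ) : Set (Mtr g) :=
  {x | ∃ C : TropicalCurve g, C.toMtr = x ∧
    C.Loopless ∧ C.ThreeVertexConnected ∧ C.genus = g}

/-- The locus of the tropical curves whose combinatorial type `(Γ, w)` is such that `Γ` is simple,
`3`-vertex-connected and of genus `g`. -/
def simpleThreeConnectedLocus (g : ℕ) : Set (Mtr g) :=
  {x | ∃ C : TropicalCurve g, C.toMtr = x ∧
    C.Simple ∧ C.ThreeVertexConnected ∧ C.genus = g}

end TropicalTorelli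

namespace TropicalTorelli

open scoped NNReal

namespace Multigraph

variable (G : Multigraph)

/-- Two vertices are connected through `S` if and only if they are not separated by a vertex set
that no edge of `S` leaves. -/
theorem reachable_adjVia_iff (S : Set G.E) (a b : G.V) :
    (G.adjVia S).Reachable a b ↔
      ∀ P : G.V → Prop, (∀ e ∈ S, (P (G.src e) ↔ P (G.tgt e))) → P a → P b := by
  constructor
  · rintro ⟨p⟩ P hP
    induction p with
    | nil => exact id
    | @cons a b d hab _ ih =>
      intro ha
      refine ih ?_
      rw [adjVia_adj] at hab
      obtain ⟨⟨e, he, hee⟩, -⟩ := hab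
      rw [ends, Sym2.eq_iff] at hee
      rcases hee with h | h
      · rw [← h.2, ← hP e he, h.1]; exact ha
      · rw [← h.1, hP e he, h.2]; exact ha
  · intro h
    refine h ((G.adjVia S).Reachable a) (fun e he => ?_) (SimpleGraph.Reachable.refl _)
    have : (G.adjVia S).Reachable (G.src e) (G.tgt e) := by
      by_cases hl : G.src e = G.tgt e
      · rw [hl]
      · exact SimpleGraph.Adj.reachable ((G.adjVia_adj S _ _).2 ⟨⟨e, he, rfl⟩, hl⟩)
    exact ⟨fun h => h.trans this, fun h => h.trans this.symm⟩

theorem Connected.forall_of_forall_edge {G : Multigraph} (h : G.Connected) (P : G.V → Prop)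
    (hP : ∀ e, (P (G.src e) ↔ P (G.tgt e))) {a : G.V} (ha : P a) (b : G.V) : P b :=
  (G.reachable_adjVia_iff Set.univ a b).1 (h.preconnected a b) P (fun e _ => hP e) ha

theorem preconnected_induce_iff (s : Set G.V) :
    ((G.adjVia Set.univ).induce s).Preconnected ↔
      ∀ P : G.V → Prop, (∀ e, G.src e ∈ s → G.tgt e ∈ s → (P (G.src e) ↔ P (G.tgt e))) →
        ∀ a ∈ s, ∀ b ∈ s, P a → P b := by
  constructor
  · intro h P hP a ha b hb
    obtain ⟨p⟩ := h ⟨a, ha⟩ ⟨b, hb⟩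
    have key : ∀ x y : s, ((G.adjVia Set.univ).induce s).Walk x y → P x.1 → P y.1 := by
      intro x y p
      induction p with
      | nil => exact id
      | @cons x y z hab _ ih =>
        intro hx
        refine ih ?_
        rw [SimpleGraph.comap_adj] at hab
        obtain ⟨⟨e, -, hee⟩, -⟩ := (adjVia_adj _ _ _ _).1 hab
        rw [ends, Sym2.eq_iff] at hee
        rcases hee with h | h
        · have := hP e (by rw [h.1]; exact x.2) (by rw [h.2]; exact y.2)
          rw [h.1, h.2] at this
          exact this.1 hx
        · have := hP e (by rw [h.1]; exact y.2) (by rw [h.2]; exact x.2)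
          rw [h.1, h.2] at this
          exact this.2 hx
    exact key _ _ p
  · rintro h ⟨a, ha⟩ ⟨b, hb⟩
    have := h (fun x => ∃ hx : x ∈ s, ((G.adjVia Set.univ).induce s).Reachable ⟨a, ha⟩ ⟨x, hx⟩)
      (fun e hs ht => ?_) a ha b hb ⟨ha, SimpleGraph.Reachable.refl _⟩
    · exact this.2
    · have : ((G.adjVia Set.univ).induce s).Reachable ⟨G.src e, hs⟩ ⟨G.tgt e, ht⟩ := by
        by_cases hl : G.src e = G.tgt e
        · simp only [hl]; exact SimpleGraph.Reachable.refl _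
        · exact SimpleGraph.Adj.reachable
            ((G.adjVia_adj Set.univ _ _).2 ⟨⟨e, trivial, rfl⟩, hl⟩)
      exact ⟨fun h => ⟨ht, h.2.trans this⟩, fun h => ⟨hs, h.2.trans this.symm⟩⟩

theorem ThreeVertexConnected.forall_of_forall_edge {G : Multigraph} (h : G.ThreeVertexConnected)
    (u v : G.V) (P : G.V → Prop)
    (hP : ∀ e, G.src e ≠ u → G.src e ≠ v → G.tgt e ≠ u → G.tgt e ≠ v →
      (P (G.src e) ↔ P (G.tgt e)))
    {a b : G.V} (hau : a ≠ u) (hav : a ≠ v) (hbu : b ≠ u) (hbv : b ≠ v) (ha : P a) : P b := by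
  refine (G.preconnected_induce_iff ({u, v}ᶜ : Set G.V)).1 (h.2 u v) P ?_ a ?_ b ?_ ha
  · intro e hs ht
    simp only [Set.mem_compl_iff, Set.mem_insert_iff, Set.mem_singleton_iff, not_or] at hs ht
    exact hP e hs.1 hs.2 ht.1 ht.2
  · simp [hau, hav]
  · simp [hbu, hbv]

section Chains

variable (R : Type*) [CommRing R]

open Classical in
theorem boundary_single (e : G.E) (r : R) :
    G.boundary R (Pi.single e r) = Pi.single (G.tgt e) r - Pi.single (G.src e) r := by
  rw [boundary, Fintype.linearCombination_apply_single, smul_sub]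
  simp [← Pi.single_smul]

theorem sum_mul_boundary (φ : G.V → R) (c : G.E → R) :
    ∑ v, φ v * G.boundary R c v = ∑ e, c e * (φ (G.tgt e) - φ (G.src e)) := by
  classical
  simp_rw [boundary_apply, Finset.mul_sum]
  rw [Finset.sum_comm]
  refine Finset.sum_congr rfl fun e _ => ?_
  simp_rw [mul_left_comm (φ _) (c e)]
  rw [← Finset.mul_sum]
  simp [mul_sub]

theorem sum_mul_eq_zero_of_mem_H1 {c : G.E → R} (hc : c ∈ G.H1 R) (φ : G.V → R) :
    ∑ e, c e * (φ (G.tgt e) - φ (G.src e)) = 0 := by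
  rw [← sum_mul_boundary, LinearMap.mem_ker.1 hc]
  simp

open Classical in
/-- A chain supported on `S` joining two vertices which are connected through `S`. -/
theorem exists_chain_of_reachable {S : Set G.E} {a b : G.V} (h : (G.adjVia S).Reachable a b) :
    ∃ c : G.E → R, (∀ e ∉ S, c e = 0) ∧
      G.boundary R c = Pi.single b 1 - Pi.single a 1 := by
  refine (G.reachable_adjVia_iff S a b).1 h
    (fun b => ∃ c : G.E → R, (∀ e ∉ S, c e = 0) ∧
      G.boundary R c = Pi.single b 1 - Pi.single a 1) (fun e he => ⟨?_, ?_⟩) ⟨0, by simp, by simp⟩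
  · rintro ⟨c, hc, hb⟩
    refine ⟨c + Pi.single e 1, fun f hf => ?_, ?_⟩
    · rw [Pi.add_apply, hc f hf, Pi.single_eq_of_ne (by rintro rfl; exact hf he), add_zero]
    · rw [map_add, hb, boundary_single]; abel
  · rintro ⟨c, hc, hb⟩
    refine ⟨c - Pi.single e 1, fun f hf => ?_, ?_⟩
    · rw [Pi.sub_apply, hc f hf, Pi.single_eq_of_ne (by rintro rfl; exact hf he), sub_zero]
    · rw [map_sub, hb, boundary_single]; abel

end Chains

open Classical in
/-- Through every edge in the support of an integral cycle `y` there is an integral cycle with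
coefficients in `{0, 1, -1}` all of whose nonzero coefficients have the same sign as those of
`y`. -/
theorem exists_conformal_cycle {y : G.E → ℤ} (hy : y ∈ G.H1 ℤ) {e : G.E} (he : y e ≠ 0) :
    ∃ c ∈ G.H1 ℤ, (∀ f, c f = 0 ∨ c f = (y f).sign) ∧ c e = (y e).sign := by
  let head : G.E → G.V := fun f => if 0 < y f then G.tgt f else G.src f
  let tail : G.E → G.V := fun f => if 0 < y f then G.src f else G.tgt f
  have hbd : ∀ f, y f ≠ 0 → G.boundary ℤ (Pi.single f (y f).sign) =
      Pi.single (head f) 1 - Pi.single (tail f) 1 := by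
    intro f hf
    rw [boundary_single]
    rcases lt_or_gt_of_ne hf with h | h
    · simp only [head, tail, Int.sign_eq_neg_one_of_neg h, if_neg h.le.not_gt, Pi.single_neg]
      abel
    · simp only [head, tail, Int.sign_eq_one_of_pos h, if_pos h]
  let good : Finset G.V → Prop := fun X => head e ∈ X ∧ ∀ v ∈ X, ∃ c : G.E → ℤ,
    (∀ f, c f = 0 ∨ c f = (y f).sign) ∧ c e = 0 ∧
    (∀ f, c f ≠ 0 → G.src f ∈ X ∧ G.tgt f ∈ X) ∧
    G.boundary ℤ c = Pi.single v 1 - Pi.single (head e) 1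
  have h0 : good {head e} := by
    refine ⟨Finset.mem_singleton_self _, fun v hv => ?_⟩
    rw [Finset.mem_singleton] at hv
    subst hv
    exact ⟨0, by simp, by simp, by simp, by simp⟩
  obtain ⟨X, -, ⟨hX, hmax⟩⟩ := Finite.exists_le_maximal h0
  have hs : tail e ∈ X := by
    by_contra hs
    have hclosed : ∀ f, y f ≠ 0 → tail f ∈ X → head f ∈ X := by
      intro f hf ht
      by_contra hh
      have hfe : e ≠ f := by rintro rfl; exact hs ht
      have hgood : good (insert (head f) X) := by
        refine ⟨Finset.mem_insert_of_mem hX.1, fun v hv => ?_⟩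
        have old : ∀ v ∈ X, ∃ c : G.E → ℤ,
            (∀ f, c f = 0 ∨ c f = (y f).sign) ∧ c e = 0 ∧
            (∀ f, c f ≠ 0 → G.src f ∈ X ∧ G.tgt f ∈ X) ∧
            G.boundary ℤ c = Pi.single v 1 - Pi.single (head e) 1 := hX.2
        rcases Finset.mem_insert.1 hv with rfl | hv
        · obtain ⟨c, hc1, hc2, hc3, hc4⟩ := old _ ht
          have hcf : c f = 0 := by
            by_contra h
            have := hc3 f h
            apply hh
            by_cases h0 : 0 < y f
            · simpa [head, h0] using this.2
            · simpa [head, h0] using this.1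
          refine ⟨c + Pi.single f (y f).sign, fun f' => ?_, ?_, fun f' hf' => ?_, ?_⟩
          · by_cases h : f' = f
            · subst h; simp [hcf]
            · simpa [h] using hc1 f'
          · simp [hc2, hfe]
          · by_cases h : f' = f
            · subst h
              by_cases h0 : 0 < y f'
              · simp only [head, tail, h0, if_true] at ht ⊢
                simp [ht]
              · simp only [head, tail, h0, if_false] at ht ⊢
                simp [ht]
            · have := hc3 f' (by simpa [h] using hf')
              exact ⟨Finset.mem_insert_of_mem this.1, Finset.mem_insert_of_mem this.2⟩
          · rw [map_add, hc4, hbd f hf]; abel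
        · obtain ⟨c, hc1, hc2, hc3, hc4⟩ := old v hv
          exact ⟨c, hc1, hc2, fun f' hf' => ⟨Finset.mem_insert_of_mem (hc3 f' hf').1,
            Finset.mem_insert_of_mem (hc3 f' hf').2⟩, hc4⟩
      exact hh (hmax hgood (Finset.subset_insert _ _) (Finset.mem_insert_self _ _))
    have hsum := G.sum_mul_eq_zero_of_mem_H1 ℤ hy (fun v => if v ∈ X then 1 else 0)
    have hnn : ∀ f ∈ Finset.univ, 0 ≤ y f *
        ((if G.tgt f ∈ X then 1 else 0) - (if G.src f ∈ X then 1 else 0)) := by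
      intro f _
      rcases lt_trichotomy (y f) 0 with h | h | h
      · have := hclosed f h.ne
        simp only [head, tail, if_neg h.le.not_gt] at this
        refine mul_nonneg_of_nonpos_of_nonpos h.le ?_
        by_cases h1 : G.tgt f ∈ X
        · simp [h1, this h1]
        · simp only [h1, if_false]; split_ifs <;> norm_num
      · simp [h]
      · have := hclosed f h.ne'
        simp only [head, tail, if_pos h] at this
        refine mul_nonneg h.le ?_
        by_cases h1 : G.src f ∈ X
        · simp [h1, this h1]
        · simp only [h1, if_false]; split_ifs <;> norm_num
    have hz := (Finset.sum_eq_zero_iff_of_nonneg hnn).1 hsum e (Finset.mem_univ e)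
    have hhd := hX.1
    by_cases h : 0 < y e
    · simp only [head, tail, if_pos h] at hs hhd
      simp [hs, hhd, he] at hz
    · simp only [head, tail, if_neg h] at hs hhd
      simp [hs, hhd, he] at hz
  obtain ⟨c, hc1, hc2, -, hc4⟩ := hX.2 _ hs
  refine ⟨c + Pi.single e (y e).sign, ?_, fun f => ?_, by simp [hc2]⟩
  · rw [LinearMap.mem_ker, map_add, hc4, hbd e he]; abel
  · by_cases h : f = e
    · subst h; simp [hc2]
    · simpa [h] using hc1 f

/-- Every class of integral cycles modulo two contains a cycle with coefficients in
`{0, 1, -1}`. -/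
theorem exists_cycle_sq_eq_emod_two {x : G.E → ℤ} (hx : x ∈ G.H1 ℤ) :
    ∃ z ∈ G.H1 ℤ, ∀ e, (x e + 2 * z e) ^ 2 = x e % 2 := by
  classical
  obtain ⟨z, hz, hmin⟩ := exists_minimalFor_of_wellFoundedLT (fun z => z ∈ G.H1 ℤ)
    (fun z : G.E → ℤ => ∑ e, (x e + 2 * z e).natAbs) ⟨0, Submodule.zero_mem _⟩
  refine ⟨z, hz, fun e => ?_⟩
  have hle : (x e + 2 * z e).natAbs ≤ 1 := by
    by_contra! hlt
    have hy : (x + (2 : ℤ) • z) ∈ G.H1 ℤ := Submodule.add_mem _ hx (Submodule.smul_mem _ _ hz)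
    have hy' : ∀ f, (x + (2 : ℤ) • z) f = x f + 2 * z f := fun f => by simp
    obtain ⟨c, hc, hcs, hce⟩ := G.exists_conformal_cycle hy (e := e) (by rw [hy']; omega)
    simp only [hy'] at hcs hce
    have hsub : ∀ f, (x f + 2 * (z - c) f).natAbs ≤ (x f + 2 * z f).natAbs ∧
        (f = e → (x f + 2 * (z - c) f).natAbs < (x f + 2 * z f).natAbs) := by
      intro f
      rw [Pi.sub_apply]
      have h1 := hcs f
      refine ⟨?_, ?_⟩
      · rcases lt_trichotomy (x f + 2 * z f) 0 with h | h | h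
        · rw [Int.sign_eq_neg_one_of_neg h] at h1; omega
        · rw [h, Int.sign_zero] at h1; omega
        · rw [Int.sign_eq_one_of_pos h] at h1; omega
      · rintro rfl
        rcases lt_or_gt_of_ne (show x f + 2 * z f ≠ 0 by omega) with h | h
        · rw [Int.sign_eq_neg_one_of_neg h] at hce; omega
        · rw [Int.sign_eq_one_of_pos h] at hce; omega
    have hlt' : ∑ f, (x f + 2 * (z - c) f).natAbs < ∑ f, (x f + 2 * z f).natAbs :=
      Finset.sum_lt_sum (fun f _ => (hsub f).1) ⟨e, Finset.mem_univ e, (hsub e).2 rfl⟩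
    exact absurd (hmin (Submodule.sub_mem _ hz hc) hlt'.le) hlt'.not_ge
  have h3 : x e + 2 * z e = 0 ∨ x e + 2 * z e = 1 ∨ x e + 2 * z e = -1 := by omega
  rcases h3 with h | h | h <;> rw [h] <;> norm_num <;> omega

end Multigraph

section Characters

variable {Λ : Type*} [AddCommGroup Λ]

/-- The sign character `x ↦ (-1) ^ ξ x` attached to a functional with values in `ℤ / 2`. -/
def signChar (ξ : Λ →+ ZMod 2) : Multiplicative Λ →* ℝ where
  toFun x := if ξ x.toAdd = 0 then 1 else -1
  map_one' := by simp
  map_mul' x y := by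
    rw [toAdd_mul, map_add]
    generalize ξ x.toAdd = a
    generalize ξ y.toAdd = b
    revert a b
    have : ∀ a : ZMod 2, a = 0 ∨ a = 1 := by decide
    intro a b
    rcases this a with rfl | rfl <;> rcases this b with rfl | rfl <;>
      simp [show (1 + 1 : ZMod 2) = 0 from rfl]

theorem signChar_apply (ξ : Λ →+ ZMod 2) (x : Λ) :
    signChar ξ (Multiplicative.ofAdd x) = if ξ x = 0 then 1 else -1 := rfl

theorem signChar_injective : Function.Injective (signChar (Λ := Λ)) := by
  intro ξ η h
  ext x
  have hx := DFunLike.congr_fun h (Multiplicative.ofAdd x)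
  rw [signChar_apply, signChar_apply] at hx
  have h2 : ∀ a b : ZMod 2, (a = 0 ↔ b = 0) → a = b := by decide
  refine h2 _ _ ?_
  by_cases h0 : ξ x = 0 <;> by_cases h1 : η x = 0 <;> simp [h0, h1] at hx ⊢ <;> norm_num at hx

/-- The indicator functions of the complements of the kernels of the nonzero functionals with
values in `ℤ / 2` are linearly independent. -/
theorem linearIndependent_indicator_ne_zero :
    LinearIndependent ℝ (fun (ξ : {ξ : Λ →+ ZMod 2 // ξ ≠ 0}) (x : Λ) =>
      if ξ.1 x = 0 then (0 : ℝ) else 1) := by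
  classical
  have hli : LinearIndependent ℝ
      (fun (ξ : Λ →+ ZMod 2) => (signChar ξ : Multiplicative Λ → ℝ)) :=
    (linearIndependent_monoidHom (Multiplicative Λ) ℝ).comp signChar signChar_injective
  rw [linearIndependent_iff'] at hli ⊢
  intro s a hs ξ hξ
  let t : Finset (Λ →+ ZMod 2) := s.map (Function.Embedding.subtype _)
  have ht : (0 : Λ →+ ZMod 2) ∉ t := by simp [t]
  let b : (Λ →+ ZMod 2) → ℝ := fun η => if h : η ≠ 0 then - a ⟨η, h⟩ else ∑ i ∈ s, a i
  have hb : ∀ i : {ξ : Λ →+ ZMod 2 // ξ ≠ 0}, b i.1 = - a i := fun i => by simp [b, i.2]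
  have key := hli (insert 0 t) b ?_ ξ.1 (Finset.mem_insert_of_mem (by simpa [t] using ⟨ξ.2, hξ⟩))
  · rw [hb] at key; linarith
  · rw [Finset.sum_insert ht]
    ext x
    have hx := congrFun hs x.toAdd
    simp only [Finset.sum_apply, Pi.smul_apply, smul_eq_mul, Pi.zero_apply] at hx
    simp only [Pi.add_apply, Finset.sum_apply, Pi.smul_apply, smul_eq_mul, Pi.zero_apply, t,
      Finset.sum_map, Function.Embedding.subtype_apply, hb]
    have h0 : b 0 * signChar (0 : Λ →+ ZMod 2) x = ∑ i ∈ s, a i := by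
      have : signChar (0 : Λ →+ ZMod 2) x = 1 := by
        rw [← ofAdd_toAdd x, signChar_apply]; simp
      rw [this]; simp [b]
    rw [h0, ← Finset.sum_add_distrib]
    have h2 : ∑ i ∈ s, (a i + -a i * signChar i.1 x) =
        2 * ∑ i ∈ s, a i * (if i.1 x.toAdd = 0 then (0 : ℝ) else 1) := by
      rw [Finset.mul_sum]
      refine Finset.sum_congr rfl fun i _ => ?_
      rw [← ofAdd_toAdd x, signChar_apply, toAdd_ofAdd]
      split_ifs <;> ring
    rw [h2, hx, mul_zero]

/-- A positive combination of indicator functions of complements of kernels of distinct nonzero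
functionals with values in `ℤ / 2` determines the functionals and the coefficients. -/
theorem exists_equiv_of_sum_indicator_eq {E E' : Type*} [Fintype E] [Fintype E']
    {ξ : E → Λ →+ ZMod 2} {ξ' : E' → Λ →+ ZMod 2}
    (hξ : Function.Injective ξ) (hξ' : Function.Injective ξ')
    (h0 : ∀ e, ξ e ≠ 0) (h0' : ∀ e, ξ' e ≠ 0)
    {l : E → ℝ} {l' : E' → ℝ} (hl : ∀ e, 0 < l e) (hl' : ∀ e, 0 < l' e)
    (h : ∀ x, ∑ e, l e * (if ξ e x = 0 then 0 else 1) =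
      ∑ e, l' e * (if ξ' e x = 0 then 0 else 1)) :
    ∃ ψ : E ≃ E', ∀ e, ξ' (ψ e) = ξ e ∧ l' (ψ e) = l e := by
  classical
  let F : {ξ : Λ →+ ZMod 2 // ξ ≠ 0} →₀ ℝ := ∑ e, Finsupp.single ⟨ξ e, h0 e⟩ (l e)
  let F' : {ξ : Λ →+ ZMod 2 // ξ ≠ 0} →₀ ℝ := ∑ e, Finsupp.single ⟨ξ' e, h0' e⟩ (l' e)
  have hF : F = F' := by
    apply linearIndependent_indicator_ne_zero (Λ := Λ)
    ext x
    have := h x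
    simp only [F, F', map_sum, Finsupp.linearCombination_single, Finset.sum_apply, Pi.smul_apply,
      smul_eq_mul]
    exact this
  have e1 : ∀ e, F ⟨ξ e, h0 e⟩ = l e := by
    intro e
    simp only [F, Finsupp.finsetSum_apply, Finsupp.single_apply, Subtype.mk.injEq]
    simp [hξ.eq_iff]
  have e1' : ∀ e, F' ⟨ξ' e, h0' e⟩ = l' e := by
    intro e
    simp only [F', Finsupp.finsetSum_apply, Finsupp.single_apply, Subtype.mk.injEq]
    simp [hξ'.eq_iff]
  have e2 : ∀ e, ∃ e', ξ' e' = ξ e := by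
    intro e
    by_contra! hne
    have : F' ⟨ξ e, h0 e⟩ = 0 := by
      simp only [F', Finsupp.finsetSum_apply, Finsupp.single_apply, Subtype.mk.injEq]
      simp [hne]
    rw [← hF, e1] at this
    exact (hl e).ne' this
  have e2' : ∀ e', ∃ e, ξ e = ξ' e' := by
    intro e
    by_contra! hne
    have : F ⟨ξ' e, h0' e⟩ = 0 := by
      simp only [F, Finsupp.finsetSum_apply, Finsupp.single_apply, Subtype.mk.injEq]
      simp [hne]
    rw [hF, e1'] at this
    exact (hl' e).ne' this
  choose ψ hψ using e2
  choose χ hχ using e2'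
  refine ⟨⟨ψ, χ, fun e => hξ (by rw [hχ, hψ]), fun e => hξ' (by rw [hψ, hχ])⟩,
    fun e => ⟨hψ e, ?_⟩⟩
  change l' (ψ e) = l e
  rw [← e1', ← e1, hF]
  congr 2
  exact hψ e

end Characters

namespace Multigraph

variable {G : Multigraph}

/-- A cochain which vanishes on all integral cycles is a coboundary. -/
theorem Connected.exists_potential (h : G.Connected) {R : Type*} [CommRing R] (a : G.E → R)
    (ha : ∀ x ∈ G.H1 ℤ, ∑ e, a e * (x e : R) = 0) :
    ∃ φ : G.V → R, ∀ e, a e = φ (G.tgt e) - φ (G.src e) := by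
  classical
  obtain ⟨v⟩ := h.nonempty
  choose c _ hc using fun w => G.exists_chain_of_reachable ℤ (h.preconnected v w)
  refine ⟨fun w => ∑ e, a e * (c w e : R), fun e => ?_⟩
  have hx : c (G.src e) + Pi.single e 1 - c (G.tgt e) ∈ G.H1 ℤ := by
    rw [LinearMap.mem_ker, map_sub, map_add, hc, hc, boundary_single]
    abel
  have h1 := ha _ hx
  have h2 : ∀ f, a f * (((c (G.src e) + Pi.single e 1 - c (G.tgt e) : G.E → ℤ) f : ℤ) : R) =
      a f * (c (G.src e) f : R) + a f * ((Pi.single e 1 : G.E → ℤ) f : R)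
        - a f * (c (G.tgt e) f : R) := by
    intro f
    simp only [Pi.sub_apply, Pi.add_apply]
    push_cast
    ring
  simp only [h2, Finset.sum_sub_distrib, Finset.sum_add_distrib] at h1
  have h3 : ∑ f, a f * ((Pi.single e 1 : G.E → ℤ) f : R) = a e := by
    rw [Finset.sum_eq_single e]
    · simp
    · intro f _ hf; simp [hf]
    · simp
  rw [h3] at h1
  linear_combination h1

theorem Loopless.valence_le (h : G.Loopless) (v : G.V) (F : Finset G.E)
    (hF : ∀ e, G.src e = v ∨ G.tgt e = v → e ∈ F) : G.valence v ≤ F.card := by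
  classical
  rw [valence, Nat.card_eq_fintype_card, Nat.card_eq_fintype_card, Fintype.card_subtype,
    Fintype.card_subtype, ← Finset.card_union_of_disjoint]
  · refine Finset.card_le_card fun e he => hF e ?_
    simpa using he
  · rw [Finset.disjoint_filter]
    intro e _ h1 h2
    exact h e (h1.trans h2.symm)

/-- A loopless `3`-vertex-connected graph all of whose valences are at least three is
`3`-edge-connected. -/
theorem ThreeVertexConnected.not_cut_subset_pair (h : G.ThreeVertexConnected) (hl : G.Loopless)
    (hv : ∀ v, 3 ≤ G.valence v) (P : G.V → Prop) {e f : G.E}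
    (he : ¬ (P (G.src e) ↔ P (G.tgt e)))
    (hcut : ∀ e', ¬ (P (G.src e') ↔ P (G.tgt e')) → e' = e ∨ e' = f) : False := by
  classical
  have exends : ∀ e', ¬ (P (G.src e') ↔ P (G.tgt e')) → ∃ a b, P a ∧ ¬ P b ∧
      (a = G.src e' ∨ a = G.tgt e') ∧ (b = G.src e' ∨ b = G.tgt e') := by
    intro e' h'
    by_cases h1 : P (G.src e')
    · exact ⟨_, _, h1, fun h2 => h' ⟨fun _ => h2, fun _ => h1⟩, .inl rfl, .inr rfl⟩
    · refine ⟨G.tgt e', _, ?_, h1, .inr rfl, .inl rfl⟩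
      by_contra h2
      exact h' ⟨fun h => (h1 h).elim, fun h => (h2 h).elim⟩
  obtain ⟨f', hf', hcut'⟩ : ∃ f', ¬ (P (G.src f') ↔ P (G.tgt f')) ∧
      ∀ e', ¬ (P (G.src e') ↔ P (G.tgt e')) → e' = e ∨ e' = f' := by
    by_cases hf : P (G.src f) ↔ P (G.tgt f)
    · refine ⟨e, he, fun e' h' => ?_⟩
      rcases hcut e' h' with h1 | rfl
      · exact .inl h1
      · exact (h' hf).elim
    · exact ⟨f, hf, hcut⟩
  obtain ⟨a, -, ha, -, ha', -⟩ := exends e he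
  obtain ⟨-, b, -, hb, -, hb'⟩ := exends f' hf'
  have small : ∀ v (Q : G.V → Prop), (∀ w, Q w ↔ w = v) → (∀ w w', (P w ↔ P w') ↔ (Q w ↔ Q w')) →
      False := by
    intro v Q hQ hPQ
    have h1 := hl.valence_le v {e, f'} fun e' h' => by
      have : ¬ (P (G.src e') ↔ P (G.tgt e')) := by
        rw [hPQ, hQ, hQ]
        have := hl e'
        rcases h' with h' | h'
        · intro hh; exact this (h'.trans (hh.1 h').symm)
        · intro hh; exact this ((hh.2 h').trans h'.symm)
      simpa using hcut' e' this
    have := hv v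
    have := Finset.card_le_two (a := e) (b := f')
    omega
  have hP : ∀ e', G.src e' ≠ a → G.src e' ≠ b → G.tgt e' ≠ a → G.tgt e' ≠ b →
      (P (G.src e') ↔ P (G.tgt e')) := by
    intro e' h1 h2 h3 h4
    by_contra hc
    rcases hcut' e' hc with rfl | rfl
    · rcases ha' with h | h
      · exact h1 h.symm
      · exact h3 h.symm
    · rcases hb' with h | h
      · exact h2 h.symm
      · exact h4 h.symm
  by_cases hrest : ∃ c, c ≠ a ∧ c ≠ b ∧ P c
  · obtain ⟨c, hca, hcb, hc⟩ := hrest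
    refine small b (fun w => ¬ P w) (fun w => ⟨fun hw => ?_, fun hw => hw ▸ hb⟩)
      (fun w w' => not_iff_not.symm)
    by_contra hwb
    refine hw (h.forall_of_forall_edge a b P hP hca hcb ?_ hwb hc)
    rintro rfl
    exact hw ha
  · push Not at hrest
    refine small a P (fun w => ⟨fun hw => ?_, fun hw => hw ▸ ha⟩) (fun w w' => Iff.rfl)
    by_contra hwa
    refine hrest w hwa ?_ hw
    rintro rfl
    exact hb hw

/-- The reduction modulo two of the coefficient of an integral cycle at an edge. -/
def coeffModTwo (G : Multigraph) (e : G.E) : G.H1 ℤ →+ ZMod 2 where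
  toFun x := ((x : G.E → ℤ) e : ZMod 2)
  map_zero' := by simp
  map_add' x y := by simp

@[simp]
theorem coeffModTwo_apply (e : G.E) (x : G.H1 ℤ) :
    G.coeffModTwo e x = ((x : G.E → ℤ) e : ZMod 2) := rfl

theorem ThreeVertexConnected.coeffModTwo_ne_zero (h : G.ThreeVertexConnected) (hl : G.Loopless)
    (hv : ∀ v, 3 ≤ G.valence v) (e : G.E) : G.coeffModTwo e ≠ 0 := by
  classical
  intro h0
  obtain ⟨φ, hφ⟩ := h.1.exists_potential (Pi.single e 1 : G.E → ZMod 2) fun x hx => by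
    have := DFunLike.congr_fun h0 ⟨x, hx⟩
    simpa [Pi.single_apply] using this
  have h2 : ∀ a b : ZMod 2, (a = 0 ↔ b = 0) → a = b := by decide
  refine h.not_cut_subset_pair hl hv (fun v => φ v = 0) (e := e) (f := e) (fun h1 => ?_)
    fun e' h' => ?_
  · have := hφ e
    rw [h2 _ _ h1] at this
    simp at this
  · by_contra hne
    have := hφ e'
    rw [Pi.single_eq_of_ne (by tauto)] at this
    rw [sub_eq_zero.1 this.symm] at h'
    exact h' Iff.rfl

theorem ThreeVertexConnected.coeffModTwo_injective (h : G.ThreeVertexConnected) (hl : G.Loopless)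
    (hv : ∀ v, 3 ≤ G.valence v) : Function.Injective G.coeffModTwo := by
  classical
  intro e f hef
  by_contra hne
  obtain ⟨φ, hφ⟩ := h.1.exists_potential (Pi.single e 1 - Pi.single f 1 : G.E → ZMod 2)
    fun x hx => by
      have := DFunLike.congr_fun hef ⟨x, hx⟩
      simpa [Pi.single_apply, sub_mul, sub_eq_zero] using this
  have h2 : ∀ a b : ZMod 2, (a = 0 ↔ b = 0) → a = b := by decide
  refine h.not_cut_subset_pair hl hv (fun v => φ v = 0) (e := e) (f := f) (fun h1 => ?_)
    fun e' h' => ?_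
  · have := hφ e
    rw [h2 _ _ h1] at this
    simp [hne] at this
  · by_contra hne
    push Not at hne
    have := hφ e'
    rw [Pi.sub_apply, Pi.single_eq_of_ne hne.1, Pi.single_eq_of_ne hne.2, sub_zero] at this
    rw [sub_eq_zero.1 this.symm] at h'
    exact h' Iff.rfl

/-- The minimum of the form `∑ l e * x e ^ 2` on a class of integral cycles modulo two is the total
length of the edges at which the class is odd. -/
theorem isLeast_sum_mul_sq {l : G.E → ℝ} (hl : ∀ e, 0 < l e) (x : G.H1 ℤ) :
    IsLeast (Set.range fun z : G.H1 ℤ => ∑ e, l e * (((x + 2 • z : G.H1 ℤ) : G.E → ℤ) e : ℝ) ^ 2)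
      (∑ e, l e * (if G.coeffModTwo e x = 0 then 0 else 1)) := by
  have hmod : ∀ e, (if G.coeffModTwo e x = 0 then (0 : ℝ) else 1) =
      (((x : G.E → ℤ) e % 2 : ℤ) : ℝ) := by
    intro e
    have h2 : (((x : G.E → ℤ) e : ℤ) : ZMod 2) = 0 ↔ 2 ∣ (x : G.E → ℤ) e := by
      exact_mod_cast ZMod.intCast_zmod_eq_zero_iff_dvd ((x : G.E → ℤ) e) 2
    rw [coeffModTwo_apply]
    split_ifs with h
    · rw [h2] at h
      rw [Int.emod_eq_zero_of_dvd h]; simp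
    · have : (x : G.E → ℤ) e % 2 = 1 := by rw [h2] at h; omega
      rw [this]; simp
  have hval : ∀ (z : G.H1 ℤ) e, ((x + 2 • z : G.H1 ℤ) : G.E → ℤ) e =
      (x : G.E → ℤ) e + 2 * (z : G.E → ℤ) e := fun z e => by simp
  simp only [hmod, hval]
  constructor
  · obtain ⟨z, hz, h⟩ := G.exists_cycle_sq_eq_emod_two x.2
    refine ⟨⟨z, hz⟩, Finset.sum_congr rfl fun e _ => ?_⟩
    rw [← h e]
    push_cast
    rfl
  · rintro _ ⟨z, rfl⟩
    refine Finset.sum_le_sum fun e _ => mul_le_mul_of_nonneg_left ?_ (hl e).le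
    have : (x : G.E → ℤ) e % 2 ≤ ((x : G.E → ℤ) e + 2 * (z : G.E → ℤ) e) ^ 2 := by
      rcases Int.emod_two_eq_zero_or_one ((x : G.E → ℤ) e) with h | h
      · rw [h]; positivity
      · rw [h]
        have : (x : G.E → ℤ) e + 2 * (z : G.E → ℤ) e ≠ 0 := by omega
        have := sq_pos_of_ne_zero this
        omega
    exact_mod_cast this

end Multigraph

namespace TropicalCurve

variable {g : ℕ} (C : TropicalCurve g)

/-- An integral cycle as an element of `H₁(Γ, ℝ) ⊕ ℝ^|w|`. -/
def ofCycle : C.H1 ℤ →+ C.JacSpace where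
  toFun x := (⟨fun e => ((x : C.E → ℤ) e : ℝ), by
    have h := LinearMap.mem_ker.1 x.2
    rw [LinearMap.mem_ker]
    ext v
    have h2 := congrArg (Int.cast (R := ℝ)) (congrFun h v)
    rw [Multigraph.boundary_apply] at h2 ⊢
    push_cast at h2
    simpa using h2⟩, 0)
  map_zero' := by ext <;> simp
  map_add' x y := by ext <;> simp

theorem ofCycle_fst (x : C.H1 ℤ) (e : C.E) :
    ((C.ofCycle x).1 : C.E → ℝ) e = ((x : C.E → ℤ) e : ℝ) := rfl

theorem ofCycle_mem (x : C.H1 ℤ) : C.ofCycle x ∈ C.jacLattice :=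
  ⟨fun e => ⟨(x : C.E → ℤ) e, rfl⟩, fun _ => ⟨0, by simp [ofCycle]⟩⟩

theorem ofCycle_injective : Function.Injective C.ofCycle := by
  intro x y h
  ext e
  have := C.ofCycle_fst x e
  rw [h, ofCycle_fst] at this
  exact_mod_cast this.symm

theorem exists_ofCycle_eq (h : C.totalWeight = 0) {y : C.JacSpace} (hy : y ∈ C.jacLattice) :
    ∃ x, C.ofCycle x = y := by
  classical
  choose n hn using hy.1
  have hmem : n ∈ C.H1 ℤ := by
    rw [LinearMap.mem_ker]
    ext v
    have h1 := congrFun (LinearMap.mem_ker.1 y.1.2) v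
    rw [Multigraph.boundary_apply] at h1 ⊢
    simp only [← hn] at h1
    have : ((∑ e, n e * ((if C.tgt e = v then 1 else 0) - (if C.src e = v then 1 else 0)) : ℤ) : ℝ)
        = 0 := by
      push_cast
      exact h1
    exact_mod_cast this
  refine ⟨⟨n, hmem⟩, Prod.ext ?_ ?_⟩
  · ext e
    exact hn e
  · ext i
    exact absurd i.2 (by simp [h])

/-- An isomorphism of Jacobians of graphs without weights restricts to an isomorphism of the
lattices of integral cycles. -/
theorem exists_addEquiv_of_jac_iso {C C' : TropicalCurve g} (h : C.totalWeight = 0)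
    (h' : C'.totalWeight = 0) (hiso : C.Jac.Iso C'.Jac) :
    ∃ φ : C.H1 ℤ ≃+ C'.H1 ℤ, ∀ x,
      ∑ e, C'.l e * ((φ x : C'.E → ℤ) e : ℝ) ^ 2 = ∑ e, C.l e * ((x : C.E → ℤ) e : ℝ) ^ 2 := by
  obtain ⟨T, hT, hQ⟩ := hiso
  change C.JacSpace ≃ₗ[ℝ] C'.JacSpace at T
  change ∀ x : C.JacSpace, T x ∈ C'.jacLattice ↔ x ∈ C.jacLattice at hT
  change ∀ x : C.JacSpace, C'.jacForm (T x) = C.jacForm x at hQ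
  choose f hf using fun x => C'.exists_ofCycle_eq h' ((hT _).2 (C.ofCycle_mem x))
  have hadd : ∀ x y, f (x + y) = f x + f y := fun x y =>
    C'.ofCycle_injective (by rw [map_add, hf, hf, hf, map_add, map_add])
  refine ⟨AddEquiv.ofBijective (AddMonoidHom.mk' f hadd) ⟨fun x y hxy => ?_, fun y => ?_⟩,
    fun x => ?_⟩
  · change f x = f y at hxy
    apply C.ofCycle_injective
    apply T.injective
    rw [← hf, ← hf, hxy]
  · have hy : T.symm (C'.ofCycle y) ∈ C.jacLattice := by
      rw [← hT, LinearEquiv.apply_symm_apply]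
      exact C'.ofCycle_mem y
    obtain ⟨x, hx⟩ := C.exists_ofCycle_eq h hy
    refine ⟨x, C'.ofCycle_injective ?_⟩
    change C'.ofCycle (f x) = _
    rw [hf, hx, LinearEquiv.apply_symm_apply]
  · have := hQ (C.ofCycle x)
    rw [← hf, jacForm_apply, jacForm_apply] at this
    exact this

/-- The Jacobian of a loopless `3`-vertex-connected curve without weights determines the edges,
their lengths and the integral cycles modulo two. -/
theorem exists_edge_equiv_of_jac_iso {C C' : TropicalCurve g} (hw : C.totalWeight = 0)
    (hw' : C'.totalWeight = 0) (hl : C.Loopless) (hl' : C'.Loopless)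
    (h3 : C.ThreeVertexConnected) (h3' : C'.ThreeVertexConnected)
    (hiso : C.Jac.Iso C'.Jac) :
    ∃ (φ : C.H1 ℤ ≃+ C'.H1 ℤ) (ψ : C.E ≃ C'.E), (∀ e, C'.l (ψ e) = C.l e) ∧
      ∀ e x, C'.coeffModTwo (ψ e) (φ x) = C.coeffModTwo e x := by
  obtain ⟨φ, hφ⟩ := exists_addEquiv_of_jac_iso hw hw' hiso
  have hval : ∀ (D : TropicalCurve g), D.totalWeight = 0 → ∀ v, 3 ≤ D.valence v := by
    intro D hD v
    refine D.stable v ?_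
    rw [WeightedGraph.totalWeight, Finset.sum_eq_zero_iff] at hD
    exact hD v (Finset.mem_univ v)
  have hsum : ∀ x, ∑ e, C.l e * (if C.coeffModTwo e x = 0 then 0 else 1) =
      ∑ e, C'.l e * (if (C'.coeffModTwo e).comp φ.toAddMonoidHom x = 0 then 0 else 1) := by
    intro x
    have h1 := C.toMultigraph.isLeast_sum_mul_sq C.l_pos x
    have h2 := C'.toMultigraph.isLeast_sum_mul_sq C'.l_pos (φ x)
    refine h1.unique ?_
    rw [← φ.surjective.range_comp] at h2
    refine (congrArg (IsLeast · _) (congrArg Set.range (funext fun z => ?_))).mp h2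
    rw [← hφ, map_add, map_nsmul]
    rfl
  obtain ⟨ψ, hψ⟩ := exists_equiv_of_sum_indicator_eq
    (h3.coeffModTwo_injective hl (hval C hw))
    (ξ' := fun e => (C'.coeffModTwo e).comp φ.toAddMonoidHom)
    (fun e f hef => h3'.coeffModTwo_injective hl' (hval C' hw') (by
      ext y
      have := DFunLike.congr_fun hef (φ.symm y)
      simpa using this))
    (h3.coeffModTwo_ne_zero hl (hval C hw))
    (fun e he => h3'.coeffModTwo_ne_zero hl' (hval C' hw') e (by
      ext y
      have := DFunLike.congr_fun he (φ.symm y)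
      simpa using this)) C.l_pos C'.l_pos hsum
  exact ⟨φ, ψ, fun e => (hψ e).2, fun e x => DFunLike.congr_fun (hψ e).1 x⟩

end TropicalCurve

theorem and_iff_and_iff_not {a b c d : Prop} (h : c ↔ d) (h' : ¬ (a ↔ b)) :
    ((a ∧ c) ↔ (b ∧ d)) ↔ ¬ c := by
  tauto

namespace Multigraph

variable {G G' : Multigraph}

/-- The vertex `v` is an end of the edge `e`. -/
def Inc (G : Multigraph) (e : G.E) (v : G.V) : Prop := G.src e = v ∨ G.tgt e = v

/-- Every cut of `G` corresponds under `ψ` to a cut of `G'`. -/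
def MapsCuts (ψ : G.E ≃ G'.E) : Prop :=
  ∀ P : G.V → Prop, ∃ P' : G'.V → Prop, ∀ e, (P (G.src e) ↔ P (G.tgt e)) ↔
    (P' (G'.src (ψ e)) ↔ P' (G'.tgt (ψ e)))

theorem Loopless.inc_iff (h : G.Loopless) (e : G.E) (v : G.V) :
    G.Inc e v ↔ ¬ (G.src e = v ↔ G.tgt e = v) := by
  have := h e
  constructor
  · rintro (h1 | h1)
    · intro h2; exact this (h1.trans (h2.1 h1).symm)
    · intro h2; exact this ((h2.2 h1).trans h1.symm)
  · intro h1
    by_contra h2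
    simp only [Inc, not_or] at h2
    tauto

theorem exists_inc (hv : ∀ v, 3 ≤ G.valence v) (v : G.V) : ∃ e, G.Inc e v := by
  by_contra! h
  have := hv v
  have h1 : IsEmpty {e // G.src e = v} := ⟨fun e => h e.1 (.inl e.2)⟩
  have h2 : IsEmpty {e // G.tgt e = v} := ⟨fun e => h e.1 (.inr e.2)⟩
  simp [valence] at this

/-- The stars of the vertices of a `3`-vertex-connected graph are recognized from the cuts of the
graph. -/
theorem exists_star_eq {ψ : G.E ≃ G'.E} (hl : G.Loopless) (hl' : G'.Loopless)
    (h3 : G'.ThreeVertexConnected) (hv : ∀ v, ∃ e, G.Inc e v) (hv' : ∀ v, ∃ e, G'.Inc e v)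
    (hc : MapsCuts ψ) (hc' : MapsCuts ψ.symm) (v' : G'.V) :
    ∃ v, ∀ e, G.Inc e v ↔ G'.Inc (ψ e) v' := by
  obtain ⟨φ, hφ⟩ := hc' (· = v')
  have hφ' : ∀ e, (φ (G.src e) ↔ φ (G.tgt e)) ↔ ¬ G'.Inc (ψ e) v' := by
    intro e
    have := hφ (ψ e)
    rw [Equiv.symm_apply_apply] at this
    rw [← this, hl'.inc_iff, not_not]
  by_cases hiso : ∃ a, ∀ e, (φ (G.src e) ↔ φ (G.tgt e)) → ¬ G.Inc e a
  · obtain ⟨a, ha⟩ := hiso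
    refine ⟨a, ?_⟩
    obtain ⟨χ, hχ⟩ := hc (· = a)
    have hconst : ∀ x y, x ≠ v' → y ≠ v' → χ x → χ y := by
      intro x y hx hy
      refine h3.forall_of_forall_edge v' v' χ (fun e' h1 _ h2 _ => ?_) hx hx hy hy
      obtain ⟨e, rfl⟩ := ψ.surjective e'
      rw [← hχ, ← not_not (a := (_ ↔ _)), ← hl.inc_iff]
      apply ha
      rw [hφ']
      simp [Inc, h1, h2]
    have hother : ∀ e, G'.Inc (ψ e) v' → ∃ z, z ≠ v' ∧ (G.Inc e a ↔ ¬ (χ z ↔ χ v')) := by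
      intro e he
      have h1 := hl' (ψ e)
      rw [hl.inc_iff, hχ]
      rcases he with he | he
      · refine ⟨_, fun h => h1 (he.trans h.symm), ?_⟩
        rw [he, iff_comm (a := χ v')]
      · refine ⟨_, fun h => h1 (h.trans he.symm), ?_⟩
        rw [he]
    obtain ⟨e0, he0⟩ := hv a
    have he0' : G'.Inc (ψ e0) v' := by
      by_contra h
      exact ha e0 ((hφ' e0).2 h) he0
    obtain ⟨z0, hz0, h0⟩ := hother e0 he0'
    intro e
    constructor
    · intro he
      by_contra h
      exact ha e ((hφ' e).2 h) he
    · intro he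
      obtain ⟨z, hz, h⟩ := hother e he
      rw [h, show χ z ↔ χ z0 from ⟨hconst _ _ hz hz0, hconst _ _ hz0 hz⟩, ← h0]
      exact he0
  · exfalso
    push Not at hiso
    obtain ⟨e₀, he₀⟩ := hv' v'
    have hne : ¬ (φ (G.src (ψ.symm e₀)) ↔ φ (G.tgt (ψ.symm e₀))) := by
      rw [hφ', Equiv.apply_symm_apply, not_not]; exact he₀
    obtain ⟨a, ha⟩ : ∃ a, φ a := by
      by_contra! h
      exact hne ⟨fun h1 => (h _ h1).elim, fun h1 => (h _ h1).elim⟩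
    obtain ⟨b, hb⟩ : ∃ b, ¬ φ b := by
      by_contra! h
      exact hne ⟨fun _ => h _, fun _ => h _⟩
    have hsame : ∀ w e₁ e₂, w ≠ v' → G'.Inc (ψ e₁) w → G'.Inc (ψ e₂) w →
        ¬ G'.Inc (ψ e₁) v' → ¬ G'.Inc (ψ e₂) v' → φ (G.src e₁) → φ (G.src e₂) := by
      intro w e₁ e₂ hw h1 h2 h1' h2' hA
      by_contra hB
      obtain ⟨χ, hχ⟩ := hc' (· = w)
      have hχ' : ∀ e, (χ (G.src e) ↔ χ (G.tgt e)) ↔ ¬ G'.Inc (ψ e) w := by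
        intro e
        have := hχ (ψ e)
        rw [Equiv.symm_apply_apply] at this
        rw [← this, hl'.inc_iff, not_not]
      obtain ⟨f, hf⟩ := hc (fun x => χ x ∧ φ x)
      have hconst : ∀ x y, x ≠ v' → x ≠ w → y ≠ v' → y ≠ w → f x → f y := by
        intro x y hx hx' hy hy'
        refine h3.forall_of_forall_edge v' w f (fun e' k1 k2 k3 k4 => ?_) hx hx' hy hy'
        obtain ⟨e, rfl⟩ := ψ.surjective e'
        have m1 := (hφ' e).2 (by simp [Inc, k1, k3])
        have m2 := (hχ' e).2 (by simp [Inc, k2, k4])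
        rw [← hf, m1, m2]
      have hother : ∀ e, G'.Inc (ψ e) w → ¬ G'.Inc (ψ e) v' → ∃ z, z ≠ v' ∧ z ≠ w ∧
          ((f z ↔ f w) ↔ ¬ φ (G.src e)) := by
        intro e he he'
        have m1 := (hφ' e).2 he'
        have m2 := fun h => (hχ' e).1 h he
        have m3 := hf e
        have m4 := hl' (ψ e)
        simp only [Inc, not_or] at he'
        rcases he with he | he
        · refine ⟨_, he'.2, fun h => m4 (he.trans h.symm), ?_⟩
          rw [iff_comm (a := f _), ← he, ← m3]
          exact and_iff_and_iff_not m1 m2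
        · refine ⟨_, he'.1, fun h => m4 (h.trans he.symm), ?_⟩
          rw [← he, ← m3]
          exact and_iff_and_iff_not m1 m2
      obtain ⟨z1, k1, k2, k3⟩ := hother e₁ h1 h1'
      obtain ⟨z2, k4, k5, k6⟩ := hother e₂ h2 h2'
      rw [show f z1 ↔ f z2 from ⟨hconst _ _ k1 k2 k4 k5, hconst _ _ k4 k5 k1 k2⟩] at k3
      exact k3.1 (k6.2 hB) hA
    obtain ⟨eA, heA, hA⟩ := hiso a
    obtain ⟨eB, heB, hB⟩ := hiso b
    have hA' : φ (G.src eA) := by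
      rcases hA with h | h
      · rw [h]; exact ha
      · rw [heA, h]; exact ha
    have hB' : ¬ φ (G.src eB) := by
      rcases hB with h | h
      · rw [h]; exact hb
      · rw [heB, h]; exact hb
    rw [hφ'] at heA heB
    have key := h3.forall_of_forall_edge v' v'
      (fun w => ∃ e, G'.Inc (ψ e) w ∧ ¬ G'.Inc (ψ e) v' ∧ φ (G.src e))
      (fun e' h1 _ h2 _ => ?_)
      (a := G'.src (ψ eA)) (b := G'.src (ψ eB)) (fun h => heA (.inl h)) (fun h => heA (.inl h))
      (fun h => heB (.inl h)) (fun h => heB (.inl h)) ⟨eA, .inl rfl, heA, hA'⟩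
    · obtain ⟨e, k1, k2, k3⟩ := key
      exact hB' (hsame _ _ _ (fun h => heB (.inl h)) k1 (.inl rfl) k2 heB k3)
    · obtain ⟨e, rfl⟩ := ψ.surjective e'
      have he : ¬ G'.Inc (ψ e) v' := by simp [Inc, h1, h2]
      constructor
      · rintro ⟨e2, k1, k2, k3⟩
        exact ⟨e, .inr rfl, he, hsame _ _ _ h1 k1 (.inl rfl) k2 he k3⟩
      · rintro ⟨e2, k1, k2, k3⟩
        exact ⟨e, .inl rfl, he, hsame _ _ _ h2 k1 (.inr rfl) k2 he k3⟩

theorem ThreeVertexConnected.eq_of_star_eq (h3 : G.ThreeVertexConnected)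
    (hcard : 2 < Fintype.card G.V) {v w : G.V} (h : ∀ e, G.Inc e v ↔ G.Inc e w) : v = w := by
  classical
  by_contra hne
  obtain ⟨z, hz⟩ : ∃ z, z ∉ ({v, w} : Finset G.V) := by
    by_contra! hz
    have h1 : (Finset.univ : Finset G.V) ⊆ {v, w} := fun z _ => hz z
    have h2 := Finset.card_le_card h1
    have h3 := Finset.card_le_two (a := v) (b := w)
    rw [Finset.card_univ] at h2
    omega
  simp only [Finset.mem_insert, Finset.mem_singleton, not_or] at hz
  refine hz.1 (h3.forall_of_forall_edge w w (· = v) (fun e h1 _ h2 _ => ?_) hne hne hz.2 hz.2 rfl)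
  have : ¬ G.Inc e v := by rw [h]; simp [Inc, h1, h2]
  simp only [Inc, not_or] at this
  simp [this.1, this.2]

theorem sym2_eq_of_card_eq_two {V : Type} [Fintype V] (h : Fintype.card V = 2) {a b c d : V}
    (hab : a ≠ b) (hcd : c ≠ d) : s(a, b) = s(c, d) := by
  classical
  have h1 : ∀ x : V, x = c ∨ x = d := by
    intro x
    have : ({c, d} : Finset V) = Finset.univ := by
      rw [← Finset.card_eq_iff_eq_univ, Finset.card_pair hcd, h]
    have hx := Finset.mem_univ x
    rw [← this] at hx
    simpa using hx
  rw [Sym2.eq_iff]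
  rcases h1 a with rfl | rfl <;> rcases h1 b with rfl | rfl <;> simp_all

/-- A version of Whitney's theorem: a bijection between the edges of two loopless
`3`-vertex-connected graphs which preserves cuts is induced by an isomorphism. -/
theorem exists_vertex_equiv_of_mapsCuts {ψ : G.E ≃ G'.E} (hl : G.Loopless) (hl' : G'.Loopless)
    (h3 : G.ThreeVertexConnected) (h3' : G'.ThreeVertexConnected)
    (hv : ∀ v, ∃ e, G.Inc e v) (hv' : ∀ v, ∃ e, G'.Inc e v)
    (hc : MapsCuts ψ) (hc' : MapsCuts ψ.symm) :
    ∃ σ : G.V ≃ G'.V, ∀ e, G'.ends (ψ e) = (G.ends e).map σ := by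
  choose t ht using exists_star_eq hl hl' h3' hv hv' hc hc'
  choose s hs using exists_star_eq (ψ := ψ.symm) hl' hl h3 hv' hv hc' (by simpa using hc)
  have htinj : 2 < Fintype.card G'.V → Function.Injective t := by
    intro h v w hvw
    refine h3'.eq_of_star_eq h fun e => ?_
    obtain ⟨e, rfl⟩ := ψ.surjective e
    rw [← ht, ← ht, hvw]
  have hsinj : 2 < Fintype.card G.V → Function.Injective s := by
    intro h v w hvw
    refine h3.eq_of_star_eq h fun e => ?_
    obtain ⟨e, rfl⟩ := ψ.symm.surjective e
    rw [← hs, ← hs, hvw]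
  by_cases hcard : 2 < Fintype.card G'.V
  · have h1 := Fintype.card_le_of_injective t (htinj hcard)
    have h2 := Fintype.card_le_of_injective s (hsinj (by omega))
    let τ := Equiv.ofBijective t
      ((Fintype.bijective_iff_injective_and_card t).2 ⟨htinj hcard, by omega⟩)
    refine ⟨τ.symm, fun e => ?_⟩
    have hinc : ∀ v, G.Inc e v → G'.Inc (ψ e) (τ.symm v) := by
      intro v h
      rw [← ht]
      change G.Inc e (τ (τ.symm v))
      rwa [Equiv.apply_symm_apply]
    have key : G'.ends (ψ e) = s(τ.symm (G.src e), τ.symm (G.tgt e)) := by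
      refine (Sym2.mem_and_mem_iff (fun h => hl e (τ.symm.injective h))).1 ⟨?_, ?_⟩
      · rw [ends, Sym2.mem_iff]
        exact (hinc _ (.inl rfl)).imp Eq.symm Eq.symm
      · rw [ends, Sym2.mem_iff]
        exact (hinc _ (.inr rfl)).imp Eq.symm Eq.symm
    exact key
  · have hcard2 : ¬ 2 < Fintype.card G.V := by
      intro h
      have := Fintype.card_le_of_injective s (hsinj h)
      omega
    obtain ⟨v⟩ := h3.1.nonempty
    obtain ⟨v'⟩ := h3'.1.nonempty
    obtain ⟨e, -⟩ := hv v
    obtain ⟨e', -⟩ := hv' v'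
    have h1 := Fintype.one_lt_card_iff.2 ⟨_, _, hl e⟩
    have h2 := Fintype.one_lt_card_iff.2 ⟨_, _, hl' e'⟩
    have h4 : Fintype.card G'.V = 2 := by omega
    refine ⟨Fintype.equivOfCardEq (by omega), fun e => ?_⟩
    exact sym2_eq_of_card_eq_two h4 (hl' _) (fun h => hl e (Equiv.injective _ h))

/-- A bijection of edges identifying the integral cycles modulo two preserves cuts. -/
theorem mapsCuts_of_addEquiv (hG' : G'.Connected) (φ : G.H1 ℤ ≃+ G'.H1 ℤ) (ψ : G.E ≃ G'.E)
    (h : ∀ e x, G'.coeffModTwo (ψ e) (φ x) = G.coeffModTwo e x) : MapsCuts ψ := by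
  classical
  intro P
  have h2 : ∀ a b : ZMod 2, (a = 0 ↔ b = 0) → a = b := by decide
  let p : G.V → ZMod 2 := fun v => if P v then 1 else 0
  obtain ⟨q, hq⟩ := hG'.exists_potential
    (fun e' => p (G.tgt (ψ.symm e')) - p (G.src (ψ.symm e'))) fun x hx => by
      rw [← Equiv.sum_comp ψ]
      simp only [Equiv.symm_apply_apply]
      have h1 := G.sum_mul_eq_zero_of_mem_H1 ℤ (φ.symm ⟨x, hx⟩).2
        (fun v => if P v then 1 else 0)
      have h2 := congrArg (Int.cast (R := ZMod 2)) h1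
      push_cast at h2
      rw [← h2]
      refine Finset.sum_congr rfl fun e _ => ?_
      have := h e (φ.symm ⟨x, hx⟩)
      rw [AddEquiv.apply_symm_apply, coeffModTwo_apply, coeffModTwo_apply] at this
      simp only [this, p]
      rw [mul_comm]
  refine ⟨fun v => q v = 0, fun e => ?_⟩
  have := hq (ψ e)
  simp only [Equiv.symm_apply_apply] at this
  have h3 : (P (G.src e) ↔ P (G.tgt e)) ↔ p (G.tgt e) - p (G.src e) = 0 := by
    by_cases h1 : P (G.src e) <;> by_cases h2 : P (G.tgt e) <;> simp [p, h1, h2]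
  rw [h3, this, sub_eq_zero]
  exact ⟨fun h => by simp only [h], fun h => (h2 _ _ h).symm⟩

end Multigraph

namespace TropicalCurve

variable {g : ℕ}

theorem totalWeight_eq_zero {C : TropicalCurve g} (h : C.genus = g) : C.totalWeight = 0 := by
  have := C.wgenus_eq
  rw [WeightedGraph.wgenus] at this
  omega

theorem w_eq_zero {C : TropicalCurve g} (h : C.genus = g) (v : C.V) : C.w v = 0 := by
  have := totalWeight_eq_zero h
  rw [WeightedGraph.totalWeight, Finset.sum_eq_zero_iff] at this
  exact this v (Finset.mem_univ v)

/-- The tropical Torelli theorem for loopless `3`-vertex-connected curves without weights. -/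
theorem iso_of_jac_iso {C C' : TropicalCurve g} (hg : C.genus = g) (hg' : C'.genus = g)
    (hl : C.Loopless) (hl' : C'.Loopless)
    (h3 : C.ThreeVertexConnected) (h3' : C'.ThreeVertexConnected)
    (hiso : C.Jac.Iso C'.Jac) : C.Iso C' := by
  obtain ⟨φ, ψ, hlen, h⟩ := exists_edge_equiv_of_jac_iso (totalWeight_eq_zero hg)
    (totalWeight_eq_zero hg') hl hl' h3 h3' hiso
  obtain ⟨σ, hσ⟩ := Multigraph.exists_vertex_equiv_of_mapsCuts (ψ := ψ) hl hl' h3 h3'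
    (Multigraph.exists_inc fun v => C.stable v (w_eq_zero hg v))
    (Multigraph.exists_inc fun v => C'.stable v (w_eq_zero hg' v))
    (Multigraph.mapsCuts_of_addEquiv h3'.1 φ ψ h)
    (Multigraph.mapsCuts_of_addEquiv h3.1 φ.symm ψ.symm fun e x => by
      have := h (ψ.symm e) (φ.symm x)
      simpa using this.symm)
  exact ⟨σ, ψ, hσ, fun v => by rw [w_eq_zero hg, w_eq_zero hg'], hlen⟩

end TropicalCurve

theorem injOn_torelli (g : ℕ) : Set.InjOn (torelli g) (threeConnectedLocus g) := by
  rintro _ ⟨C, rfl, hl, h3, hg⟩ _ ⟨C', rfl, hl', h3', hg'⟩ h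
  exact Quotient.sound
    (TropicalCurve.iso_of_jac_iso hg hg' hl hl' h3 h3' (Quotient.exact h))

/-- Two weighted graphs are isomorphic if there are bijections of the vertices and of the edges
preserving end vertices and weights. -/
def WeightedGraph.Iso (G H : WeightedGraph) : Prop :=
  ∃ (σ : G.V ≃ H.V) (ψ : G.E ≃ H.E),
    (∀ e, H.ends (ψ e) = (G.ends e).map σ) ∧ ∀ v, H.w (σ v) = G.w v

theorem TropicalCurve.toMtr_mem_stratum {g : ℕ} (C : TropicalCurve g) (G : StableGraph g) :
    C.toMtr ∈ stratum G ↔ C.toWeightedGraph.Iso G.toWeightedGraph := by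
  constructor
  · rintro ⟨l, hl, h⟩
    obtain ⟨σ, ψ, h1, h2, -⟩ := Quotient.exact h
    exact ⟨σ, ψ, h1, h2⟩
  · rintro ⟨σ, ψ, h1, h2⟩
    refine ⟨fun e => C.l (ψ.symm e), fun e => C.l_pos _, Quotient.sound ⟨σ, ψ, h1, h2, ?_⟩⟩
    intro e
    change C.l (ψ.symm (ψ e)) = C.l e
    rw [Equiv.symm_apply_apply]

/-- The number of edges of a tropical curve, as a function on the moduli space. -/
noncomputable def edgeCount {g : ℕ} : Mtr g → ℕ :=
  Quotient.lift (fun C : TropicalCurve g => Nat.card C.E)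
    fun _ _ ⟨_, ψ, _⟩ => Nat.card_congr ψ

theorem edgeCount_of_mem_stratum {g : ℕ} {G : StableGraph g} {x : Mtr g} (h : x ∈ stratum G) :
    edgeCount x = Nat.card G.E := by
  obtain ⟨l, hl, rfl⟩ := h
  rfl

theorem edgeCount_curveOf {g : ℕ} (G : StableGraph g) (l : G.E → ℝ≥0) :
    edgeCount (G.curveOf l).toMtr = Nat.card {e // l e ≠ 0} := rfl

theorem edgeCount_curveOf_mono {g : ℕ} (G : StableGraph g) {l l' : G.E → ℝ≥0}
    (h : ∀ e, l e ≠ 0 → l' e ≠ 0) :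
    edgeCount (G.curveOf l).toMtr ≤ edgeCount (G.curveOf l').toMtr := by
  rw [edgeCount_curveOf, edgeCount_curveOf]
  exact Nat.card_le_card_of_injective _ (Subtype.impEmbedding _ _ h).injective

/-- A set of tropical curves is open if it is stable under making some more edge lengths
positive. -/
theorem isOpen_of_forall_support_subset {g : ℕ} {U : Set (Mtr g)}
    (h : ∀ (G : StableGraph g) (l l' : G.E → ℝ≥0), (∀ e, l e ≠ 0 → l' e ≠ 0) →
      (G.curveOf l).toMtr ∈ U → (G.curveOf l').toMtr ∈ U) : IsOpen U := by
  rw [isOpen_iSup_iff]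
  intro G
  rw [isOpen_coinduced, isOpen_iff_mem_nhds]
  intro l hl
  have hopen : IsOpen {l' : G.E → ℝ≥0 | ∀ e, l e ≠ 0 → l' e ≠ 0} := by
    simp only [Set.ofPred_forall]
    refine isOpen_iInter_of_finite fun e => isOpen_iInter_of_finite fun _ => ?_
    exact isOpen_ne_fun (continuous_apply e) continuous_const
  exact Filter.mem_of_superset (hopen.mem_nhds fun _ => id) fun l' hl' => h G l l' hl' hl

theorem isOpen_le_edgeCount (g k : ℕ) : IsOpen {x : Mtr g | k ≤ edgeCount x} := by
  refine isOpen_of_forall_support_subset fun G l l' hll' h => ?_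
  exact le_trans h (edgeCount_curveOf_mono G hll')

theorem isLocallyClosed_stratum {g : ℕ} (G : StableGraph g) : IsLocallyClosed (stratum G) := by
  refine ⟨{x | Nat.card G.E ≤ edgeCount x}, ({x | Nat.card G.E ≤ edgeCount x} \ stratum G)ᶜ,
    isOpen_le_edgeCount g _, ?_, ?_⟩
  · rw [isClosed_compl_iff]
    refine isOpen_of_forall_support_subset fun H l l' hll' h =>
      ⟨le_trans h.1 (edgeCount_curveOf_mono H hll'), fun hmem => h.2 ?_⟩
    · have h1 := edgeCount_of_mem_stratum hmem
      have h2 := h.1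
      rw [Set.mem_ofPred_eq, edgeCount_curveOf] at h2
      rw [edgeCount_curveOf] at h1
      have h3 : {e | l e = 0} = {e | l' e = 0} := by
        have h4 : {e | l e ≠ 0} = {e | l' e ≠ 0} :=
          Set.eq_of_subset_of_ncard_le hll' (by
            rw [← Nat.card_coe_set_eq, ← Nat.card_coe_set_eq]
            exact h1.le.trans h2)
        rw [← compl_inj_iff]
        exact h4
      rw [TropicalCurve.toMtr_mem_stratum] at hmem ⊢
      change WeightedGraph.Iso (H.contract {e | l e = 0}) _
      rw [h3]
      exact hmem
  · ext x
    constructor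
    · intro hx
      exact ⟨(edgeCount_of_mem_stratum hx).ge, fun h => h.2 hx⟩
    · rintro ⟨h1, h2⟩
      by_contra h
      exact h2 ⟨h1, h⟩

theorem Multigraph.sum_valence (G : Multigraph) : ∑ v, G.valence v = 2 * Nat.card G.E := by
  simp only [valence, Finset.sum_add_distrib]
  rw [WeightedGraph.sum_card_fiber, WeightedGraph.sum_card_fiber, two_mul]

/-- The tropical curves without weights whose underlying graph is the graph with the vertices
`Fin n` and the edges `Fin m` with ends `p`. -/
def curvesWithEnds (g : ℕ) {n m : ℕ} (p : Fin m → Sym2 (Fin n)) : Set (Mtr g) :=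
  {x | ∃ C : TropicalCurve g, x = C.toMtr ∧ C.totalWeight = 0 ∧
    ∃ (σ : C.V ≃ Fin n) (ψ : C.E ≃ Fin m), ∀ e, p (ψ e) = (C.ends e).map σ}

theorem StableGraph.exists_stratum_eq_curvesWithEnds {g : ℕ} (G : StableGraph g)
    (hG : G.genus = g) :
    ∃ n < 2 * g, ∃ m < 3 * g + 1, ∃ p : Fin m → Sym2 (Fin n),
      stratum G = curvesWithEnds g p := by
  have hw : G.totalWeight = 0 := by
    have := G.wgenus_eq
    rw [WeightedGraph.wgenus] at this
    omega
  have hw' : ∀ v, G.w v = 0 := by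
    intro v
    rw [WeightedGraph.totalWeight, Finset.sum_eq_zero_iff] at hw
    exact hw v (Finset.mem_univ v)
  have h1 : 3 * Nat.card G.V ≤ 2 * Nat.card G.E := by
    rw [← Multigraph.sum_valence]
    have := Finset.card_nsmul_le_sum Finset.univ G.valence 3 fun v _ => G.stable v (hw' v)
    rw [Nat.card_eq_fintype_card]
    simpa [mul_comm] using this
  have h2 : 0 < Nat.card G.V := by
    obtain ⟨v⟩ := G.connected.nonempty
    have : Nonempty G.V := ⟨v⟩
    exact Nat.card_pos
  rw [Multigraph.genus] at hG
  refine ⟨Nat.card G.V, by omega, Nat.card G.E, by omega,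
    fun i => (G.ends ((Finite.equivFin G.E).symm i)).map (Finite.equivFin G.V), ?_⟩
  ext x
  constructor
  · rintro ⟨l, hl, rfl⟩
    exact ⟨⟨G, l, hl⟩, rfl, hw, Finite.equivFin G.V, Finite.equivFin G.E, by simp⟩
  · rintro ⟨C, rfl, hC, σ, ψ, h⟩
    rw [TropicalCurve.toMtr_mem_stratum]
    refine ⟨σ.trans (Finite.equivFin G.V).symm, ψ.trans (Finite.equivFin G.E).symm,
      fun e => ?_, fun v => ?_⟩
    · have := congrArg (Sym2.map (Finite.equivFin G.V).symm) (h e)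
      rw [Sym2.map_map, Sym2.map_map] at this
      simpa using this
    · rw [hw']
      rw [WeightedGraph.totalWeight, Finset.sum_eq_zero_iff] at hC
      exact (hC v (Finset.mem_univ v)).symm

theorem finite_strata (g : ℕ) :
    {s : Set (Mtr g) | ∃ G : StableGraph g, G.genus = g ∧ s = stratum G}.Finite := by
  refine (Set.finite_range fun d : Σ (n : Fin (2 * g)) (m : Fin (3 * g + 1)),
    (Fin m → Sym2 (Fin n)) => curvesWithEnds g d.2.2).subset ?_
  rintro _ ⟨G, hG, rfl⟩
  obtain ⟨n, hn, m, hm, p, h⟩ := G.exists_stratum_eq_curvesWithEnds hG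
  exact ⟨⟨⟨n, hn⟩, ⟨m, hm⟩, p⟩, h.symm⟩

theorem exists_finite_strata (g : ℕ) : ∃ 𝒮 : Set (Set (Mtr g)), 𝒮.Finite ∧
    (∀ s ∈ 𝒮, IsLocallyClosed s ∧ ∃ G : StableGraph g, s = stratum G) ∧
    threeConnectedLocus g = ⋃₀ 𝒮 := by
  refine ⟨{s | ∃ G : StableGraph g,
    (G.Loopless ∧ G.ThreeVertexConnected ∧ G.genus = g) ∧ s = stratum G}, ?_, ?_, ?_⟩
  · refine (finite_strata g).subset ?_
    rintro _ ⟨G, hG, rfl⟩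
    exact ⟨G, hG.2.2, rfl⟩
  · rintro _ ⟨G, -, rfl⟩
    exact ⟨isLocallyClosed_stratum G, G, rfl⟩
  · ext x
    constructor
    · rintro ⟨C, rfl, hC⟩
      exact ⟨stratum C.toStableGraph, ⟨C.toStableGraph, hC, rfl⟩, C.l, C.l_pos, rfl⟩
    · rintro ⟨_, ⟨G, hG, rfl⟩, l, hl, rfl⟩
      exact ⟨⟨G, l, hl⟩, rfl, hG⟩

namespace Multigraph

variable {G H : Multigraph}

theorem Simple.of_iso (σ : G.V ≃ H.V) (ψ : G.E ≃ H.E)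
    (h : ∀ e, H.ends (ψ e) = (G.ends e).map σ) (hG : H.Simple) : G.Simple := by
  constructor
  · intro e he
    have h1 : H.ends (ψ e) = s(σ (G.src e), σ (G.tgt e)) := h e
    rw [he, ends, Sym2.eq_iff] at h1
    have := hG.1 (ψ e)
    rcases h1 with h1 | h1 <;> exact this (h1.1.trans h1.2.symm)
  · intro e f hef
    apply ψ.injective
    apply hG.2
    rw [h, h, hef]

theorem ThreeVertexConnected.of_iso (hconn : G.Connected) (σ : G.V ≃ H.V) (ψ : G.E ≃ H.E)
    (h : ∀ e, H.ends (ψ e) = (G.ends e).map σ) (hH : H.ThreeVertexConnected) :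
    G.ThreeVertexConnected := by
  refine ⟨hconn, fun u v => ?_⟩
  rw [preconnected_induce_iff]
  intro P hP a ha b hb hPa
  have hmem : ∀ x, x ∈ ({u, v}ᶜ : Set G.V) ↔ σ x ≠ σ u ∧ σ x ≠ σ v := fun x => by simp
  rw [hmem] at ha hb
  have key := hH.forall_of_forall_edge (σ u) (σ v) (fun y => P (σ.symm y)) (fun e' h1 h2 h3 h4 => ?_)
    ha.1 ha.2 hb.1 hb.2 (by simpa using hPa)
  · simpa using key
  · obtain ⟨e, rfl⟩ := ψ.surjective e'
    have h1' : H.ends (ψ e) = s(σ (G.src e), σ (G.tgt e)) := h e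
    rw [ends, Sym2.eq_iff] at h1'
    rcases h1' with h5 | h5
    · rw [h5.1] at h1 h2
      rw [h5.2] at h3 h4
      rw [h5.1, h5.2, Equiv.symm_apply_apply, Equiv.symm_apply_apply]
      exact hP e ((hmem _).2 ⟨h1, h2⟩) ((hmem _).2 ⟨h3, h4⟩)
    · rw [h5.1] at h1 h2
      rw [h5.2] at h3 h4
      rw [h5.1, h5.2, Equiv.symm_apply_apply, Equiv.symm_apply_apply]
      exact (hP e ((hmem _).2 ⟨h3, h4⟩) ((hmem _).2 ⟨h1, h2⟩)).symm

/-- The maps `q` on vertices and `j` on edges present `G` as the graph obtained from `H` by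
contracting the edges outside the image of `j`. -/
structure IsContraction (q : H.V → G.V) (j : G.E → H.E) : Prop where
  injective : Function.Injective j
  surjective : Function.Surjective q
  src : ∀ e, q (H.src (j e)) = G.src e
  tgt : ∀ e, q (H.tgt (j e)) = G.tgt e
  contracted : ∀ e ∉ Set.range j, q (H.src e) = q (H.tgt e)
  reachable : ∀ a b, q a = q b → (H.adjVia (Set.range j)ᶜ).Reachable a b

namespace IsContraction

variable {q : H.V → G.V} {j : G.E → H.E}

theorem sum_mul_boundary (hc : IsContraction q j) {R : Type*} [CommRing R] (z : H.E → R)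
    (φ : G.V → R) :
    ∑ x, φ (q x) * H.boundary R z x = ∑ e, z (j e) * (φ (G.tgt e) - φ (G.src e)) := by
  rw [H.sum_mul_boundary R (fun x => φ (q x)) z]
  refine (Fintype.sum_of_injective j hc.injective _ _ (fun e he => ?_) fun e => ?_).symm
  · rw [hc.contracted e he, sub_self, mul_zero]
  · rw [hc.src, hc.tgt]

theorem comp_mem_H1 (hc : IsContraction q j) {R : Type*} [CommRing R] {z : H.E → R}
    (hz : z ∈ H.H1 R) : z ∘ j ∈ G.H1 R := by
  classical
  rw [LinearMap.mem_ker]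
  ext y
  have h1 := hc.sum_mul_boundary z (Pi.single y 1)
  rw [LinearMap.mem_ker.1 hz] at h1
  replace h1 := h1.trans (Multigraph.sum_mul_boundary G R (Pi.single y 1) (z ∘ j)).symm
  simpa [Pi.single_apply] using h1.symm

theorem exists_mem_H1_comp_eq (hc : IsContraction q j) {R : Type*} [CommRing R] {z : G.E → R}
    (hz : z ∈ G.H1 R) : ∃ y ∈ H.H1 R, y ∘ j = z := by
  classical
  let z0 : H.E → R := Function.extend j z 0
  have hz0 : ∀ e, z0 (j e) = z e := fun e => hc.injective.extend_apply _ _ _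
  obtain ⟨s, hs⟩ := hc.surjective.hasRightInverse
  choose r hr hrb using fun x =>
    H.exists_chain_of_reachable R (hc.reachable (s (q x)) x (hs (q x)))
  let b := H.boundary R z0
  refine ⟨z0 - ∑ x, b x • r x, ?_, ?_⟩
  · rw [LinearMap.mem_ker, map_sub, map_sum, sub_eq_zero]
    ext v
    simp only [map_smul, hrb, Finset.sum_apply, Pi.smul_apply, Pi.sub_apply, smul_eq_mul, mul_sub,
      Finset.sum_sub_distrib]
    have h1 : ∑ x, b x * (Pi.single x 1 : H.V → R) v = b v := by
      simp [Pi.single_apply]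
    have h2 : ∑ x, b x * (Pi.single (s (q x)) 1 : H.V → R) v = 0 := by
      have h3 := hc.sum_mul_boundary z0 (fun y => (Pi.single (s y) 1 : H.V → R) v)
      simp only [hz0] at h3
      replace h3 := h3.trans (G.sum_mul_eq_zero_of_mem_H1 R hz fun y => (Pi.single (s y) 1 : H.V → R) v)
      rw [← h3]
      exact Finset.sum_congr rfl fun x _ => mul_comm _ _
    rw [h1, h2, sub_zero]
  · ext e
    simp only [Function.comp_apply, Pi.sub_apply, hz0, Finset.sum_apply, Pi.smul_apply]
    rw [Finset.sum_eq_zero, sub_zero]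
    intro x _
    rw [hr x (j e) (by simp), smul_zero]

/-- The map on the first homology induced by a contraction. -/
noncomputable def mapH1 (hc : IsContraction q j) : H.H1 ℝ →ₗ[ℝ] G.H1 ℝ :=
  (LinearMap.funLeft ℝ ℝ j).restrict fun _ hz => hc.comp_mem_H1 hz

theorem mapH1_surjective (hc : IsContraction q j) : Function.Surjective hc.mapH1 := by
  rintro ⟨z, hz⟩
  obtain ⟨y, hy, h⟩ := hc.exists_mem_H1_comp_eq hz
  exact ⟨⟨y, hy⟩, Subtype.ext h⟩

theorem genus_le (hc : IsContraction q j) (hH : H.Connected) (hG : G.Connected) :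
    G.genus ≤ H.genus := by
  rw [← finrank_H1 _ hH, ← finrank_H1 _ hG]
  exact LinearMap.finrank_le_finrank_of_surjective hc.mapH1_surjective

/-- If a contraction does not change the genus, then no nontrivial cycle is contracted. -/
theorem eq_zero_of_comp_eq_zero (hc : IsContraction q j) (hH : H.Connected) (hG : G.Connected)
    (hg : H.genus = G.genus) {z : H.E → ℝ} (hz : z ∈ H.H1 ℝ) (h : z ∘ j = 0) : z = 0 := by
  have hinj : Function.Injective hc.mapH1 := by
    rw [LinearMap.injective_iff_surjective_of_finrank_eq_finrank]
    · exact hc.mapH1_surjective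
    · rw [finrank_H1 _ hH, finrank_H1 _ hG, hg]
  have h1 : (⟨z, hz⟩ : H.H1 ℝ) = 0 := by
    apply hinj
    rw [map_zero]
    exact Subtype.ext h
  exact congrArg Subtype.val h1

/-- If a contraction onto a simple graph does not change the genus, then there is no nontrivial
cycle over two vertices. -/
theorem eq_zero_of_support (hc : IsContraction q j) (hH : H.Connected) (hG : G.Connected)
    (hg : H.genus = G.genus) (hs : G.Simple) {z : H.E → ℝ} (hz : z ∈ H.H1 ℝ) (c d : G.V)
    (hsupp : ∀ e, z e ≠ 0 → (q (H.src e) = c ∨ q (H.src e) = d) ∧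
      (q (H.tgt e) = c ∨ q (H.tgt e) = d)) : z = 0 := by
  classical
  refine hc.eq_zero_of_comp_eq_zero hH hG hg hz ?_
  have hz' := hc.comp_mem_H1 hz
  have hends : ∀ e, (z ∘ j) e ≠ 0 → G.ends e = s(c, d) := by
    intro e he
    have h1 := hsupp (j e) he
    rw [hc.src, hc.tgt] at h1
    have h2 := hs.1 e
    rw [ends, Sym2.eq_iff]
    rcases h1 with ⟨h3 | h3, h4 | h4⟩
    · exact (h2 (h3.trans h4.symm)).elim
    · exact .inl ⟨h3, h4⟩
    · exact .inr ⟨h3, h4⟩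
    · exact (h2 (h3.trans h4.symm)).elim
  by_contra hne
  obtain ⟨e, he⟩ := Function.ne_iff.1 hne
  have hsingle : z ∘ j = Pi.single e ((z ∘ j) e) := by
    ext f
    by_cases hf : f = e
    · subst hf; simp
    · rw [Pi.single_eq_of_ne hf]
      by_contra h
      exact hf (hs.2 ((hends f h).trans (hends e he).symm))
  rw [hsingle, LinearMap.mem_ker, boundary_single] at hz'
  have := congrFun hz' (G.tgt e)
  rw [Pi.sub_apply, Pi.single_eq_same, Pi.single_eq_of_ne (hs.1 e).symm, sub_zero] at this
  exact he this

end IsContraction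

open Classical in
/-- If no nontrivial cycle is supported on the edges with both ends in `X`, then the number of these
edges is smaller than the number of vertices in `X`. -/
theorem card_edges_lt_card {X : Finset H.V} (hX : X.Nonempty)
    (h : ∀ z ∈ H.H1 ℝ, (∀ e, z e ≠ 0 → H.src e ∈ X ∧ H.tgt e ∈ X) → z = 0) :
    (Finset.univ.filter fun e => H.src e ∈ X ∧ H.tgt e ∈ X).card < X.card := by
  obtain ⟨x, hx⟩ := hX
  let F := Finset.univ.filter fun e => H.src e ∈ X ∧ H.tgt e ∈ X
  let f : (F → ℝ) →ₗ[ℝ] ({v // v ∈ X.erase x} → ℝ) :=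
    LinearMap.funLeft ℝ ℝ Subtype.val ∘ₗ H.boundary ℝ ∘ₗ
      Function.ExtendByZero.linearMap ℝ (Subtype.val : F → H.E)
  have hf : Function.Injective f := by
    rw [← LinearMap.ker_eq_bot, LinearMap.ker_eq_bot']
    intro z hz
    let y : H.E → ℝ := Function.extend (Subtype.val : F → H.E) z 0
    have hy : ∀ e : F, y e = z e := fun e => Subtype.val_injective.extend_apply _ _ _
    have hy0 : ∀ e, y e ≠ 0 → H.src e ∈ X ∧ H.tgt e ∈ X := by
      intro e he
      by_contra hne
      apply he
      refine Function.extend_apply' _ _ _ ?_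
      rintro ⟨e', rfl⟩
      exact hne (Finset.mem_filter.1 e'.2).2
    have hb : ∀ v ∈ X.erase x, H.boundary ℝ y v = 0 := fun v hv => congrFun hz ⟨v, hv⟩
    have hb' : ∀ v, v ≠ x → H.boundary ℝ y v = 0 := by
      intro v hv
      by_cases hvX : v ∈ X
      · exact hb v (Finset.mem_erase.2 ⟨hv, hvX⟩)
      · rw [boundary_apply]
        refine Finset.sum_eq_zero fun e _ => ?_
        by_cases he : y e = 0
        · rw [he, zero_mul]
        · have := hy0 e he
          rw [if_neg, if_neg, sub_zero, mul_zero]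
          · rintro rfl; exact hvX this.1
          · rintro rfl; exact hvX this.2
    have hyH : y ∈ H.H1 ℝ := by
      rw [LinearMap.mem_ker]
      ext v
      by_cases hv : v = x
      · subst hv
        have := H.sum_mul_boundary ℝ (fun _ => 1) y
        rw [Finset.sum_eq_single v (fun w _ hw => by rw [hb' w hw, mul_zero]) (by simp)] at this
        simpa using this
      · exact hb' v hv
    have hy1 := h y hyH hy0
    ext e
    rw [← hy, hy1]
    rfl
  have h1 := LinearMap.finrank_le_finrank_of_injective hf
  rw [Module.finrank_fintype_fun_eq_card, Module.finrank_fintype_fun_eq_card, Fintype.card_coe,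
    Fintype.card_coe, Finset.card_erase_of_mem hx] at h1
  have h2 : 0 < X.card := Finset.card_pos.2 ⟨x, hx⟩
  change F.card < X.card
  omega

open Classical in
theorem sum_valence_eq (X : Finset H.V) : ∑ v ∈ X, H.valence v =
    (Finset.univ.filter fun e => H.src e ∈ X).card +
      (Finset.univ.filter fun e => H.tgt e ∈ X).card := by
  have key : ∀ f : H.E → H.V, ∑ v ∈ X, Nat.card {e // f e = v} =
      (Finset.univ.filter fun e => f e ∈ X).card := by
    intro f
    rw [Finset.card_eq_sum_card_fiberwise (f := f) (t := X) (by intro e he; simpa using he)]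
    refine Finset.sum_congr rfl fun v hv => ?_
    rw [Nat.card_eq_fintype_card, Fintype.card_subtype, Finset.filter_filter]
    congr 1
    ext e
    simp only [Finset.mem_filter, Finset.mem_univ, true_and]
    exact ⟨fun h => ⟨h ▸ hv, h⟩, fun h => h.2⟩
  simp only [valence, Finset.sum_add_distrib, key]

namespace IsContraction

variable {q : H.V → G.V} {j : G.E → H.E}

theorem simple (hc : IsContraction q j) (hH : H.Connected) (hG : G.Connected)
    (hg : H.genus = G.genus) (hs : G.Simple) : H.Simple := by
  classical
  have hl : H.Loopless := by
    intro e he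
    have h1 := hc.eq_zero_of_support hH hG hg hs (z := Pi.single e 1) (by
      rw [LinearMap.mem_ker, boundary_single, he, sub_self]) (q (H.src e)) (q (H.src e))
      fun f hf => by
        have : f = e := by
          by_contra h
          simp [h] at hf
        subst this
        simp [he]
    simpa using congrFun h1 e
  refine ⟨hl, fun e f hef => ?_⟩
  by_contra hne
  obtain ⟨r, hr⟩ : ∃ r : ℝ, (Pi.single e 1 + Pi.single f r : H.E → ℝ) ∈ H.H1 ℝ := by
    rw [ends, ends, Sym2.eq_iff] at hef
    rcases hef with h | h
    · refine ⟨-1, ?_⟩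
      rw [LinearMap.mem_ker, map_add, boundary_single, boundary_single, h.1, h.2]
      simp only [Pi.single_neg]
      abel
    · refine ⟨1, ?_⟩
      rw [LinearMap.mem_ker, map_add, boundary_single, boundary_single, h.1, h.2]
      abel
  have h1 := hc.eq_zero_of_support hH hG hg hs hr (q (H.src e)) (q (H.tgt e)) fun f' hf' => by
    have : f' = e ∨ f' = f := by
      by_contra! h
      simp [h.1, h.2] at hf'
    rcases this with rfl | rfl
    · simp
    · rw [ends, ends, Sym2.eq_iff] at hef
      rcases hef with h | h <;> simp [h.1, h.2]
  have := congrFun h1 e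
  simp [hne] at this

/-- A vertex set over two vertices of a simple graph of the same genus cannot be separated from the
rest of the graph by two vertices which lie over them. -/
theorem eq_empty_of_separated (hc : IsContraction q j) (hH : H.Connected) (hG : G.Connected)
    (hg : H.genus = G.genus) (hs : G.Simple) (hv : ∀ v, 3 ≤ H.valence v) (u v : H.V)
    (A : Finset H.V) (hA : ∀ x ∈ A, q x = q u ∨ q x = q v)
    (hsep : ∀ e, (H.src e ∈ A → H.tgt e ∈ A ∨ H.tgt e = u ∨ H.tgt e = v) ∧
      (H.tgt e ∈ A → H.src e ∈ A ∨ H.src e = u ∨ H.src e = v)) : A = ∅ := by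
  classical
  by_contra hne
  have hne' := Finset.nonempty_iff_ne_empty.2 hne
  let X := insert u (insert v A)
  have hAX : A ⊆ X := (Finset.subset_insert _ _).trans (Finset.subset_insert _ _)
  have hXq : ∀ x ∈ X, q x = q u ∨ q x = q v := by
    intro x hx
    simp only [X, Finset.mem_insert] at hx
    rcases hx with rfl | rfl | hx
    · exact .inl rfl
    · exact .inr rfl
    · exact hA x hx
  have hcount : ∀ Y : Finset H.V, Y.Nonempty → Y ⊆ X →
      (Finset.univ.filter fun e => H.src e ∈ Y ∧ H.tgt e ∈ Y).card < Y.card := by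
    intro Y hY hYX
    refine card_edges_lt_card hY fun z hz hsupp => ?_
    refine hc.eq_zero_of_support hH hG hg hs hz (q u) (q v) fun e he => ?_
    exact ⟨hXq _ (hYX (hsupp e he).1), hXq _ (hYX (hsupp e he).2)⟩
  have h1 := hcount A hne' hAX
  have h2 := hcount X (hne'.mono hAX) subset_rfl
  have h3 : X.card ≤ A.card + 2 :=
    (Finset.card_insert_le _ _).trans (Nat.succ_le_succ (Finset.card_insert_le _ _))
  have h4 := Finset.card_nsmul_le_sum A H.valence 3 fun v _ => hv v
  rw [sum_valence_eq, ← Finset.card_union_add_card_inter, ← Finset.filter_and, smul_eq_mul] at h4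
  have h5 : ((Finset.univ.filter fun e => H.src e ∈ A) ∪
      (Finset.univ.filter fun e => H.tgt e ∈ A)).card ≤
      (Finset.univ.filter fun e => H.src e ∈ X ∧ H.tgt e ∈ X).card := by
    refine Finset.card_le_card fun e he => ?_
    simp only [Finset.mem_union, Finset.mem_filter, Finset.mem_univ, true_and] at he ⊢
    rcases he with he | he
    · refine ⟨hAX he, ?_⟩
      simp only [X, Finset.mem_insert]
      have := (hsep e).1 he
      tauto
    · refine ⟨?_, hAX he⟩
      simp only [X, Finset.mem_insert]
      have := (hsep e).2 he
      tauto
  omega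

/-- If a contraction of a graph of minimal valence at least three does not change the genus and is
simple and `3`-vertex-connected, then the graph is `3`-vertex-connected. -/
theorem threeVertexConnected (hc : IsContraction q j) (hH : H.Connected)
    (hg : H.genus = G.genus) (hs : G.Simple) (h3 : G.ThreeVertexConnected)
    (hv : ∀ v, 3 ≤ H.valence v) : H.ThreeVertexConnected := by
  classical
  refine ⟨hH, fun u v => ?_⟩
  rw [preconnected_induce_iff]
  intro P hP
  have hfib : ∀ x y, q x = q y → q x ≠ q u → q x ≠ q v → P x → P y := by
    intro x y hxy hu hv' hx
    refine ((H.reachable_adjVia_iff _ x y).1 (hc.reachable x y hxy)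
      (fun w => q w = q x ∧ P w) (fun e he => ?_) ⟨rfl, hx⟩).2
    have h1 := hc.contracted e he
    rw [h1]
    refine and_congr_right fun h2 => hP e ?_ ?_
    · have h3 : q (H.src e) = q x := h1.trans h2
      rw [← h3] at hu hv'
      simp only [Set.mem_compl_iff, Set.mem_insert_iff, Set.mem_singleton_iff, not_or]
      exact ⟨fun h => hu (congrArg q h), fun h => hv' (congrArg q h)⟩
    · rw [← h2] at hu hv'
      simp only [Set.mem_compl_iff, Set.mem_insert_iff, Set.mem_singleton_iff, not_or]
      exact ⟨fun h => hu (congrArg q h), fun h => hv' (congrArg q h)⟩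
  have hK : ∀ x y, q x ≠ q u → q x ≠ q v → q y ≠ q u → q y ≠ q v → P x → P y := by
    intro x y hxu hxv hyu hyv hx
    obtain ⟨x', hx', hPx'⟩ := h3.forall_of_forall_edge (q u) (q v) (fun k => ∃ x, q x = k ∧ P x)
      (fun e h1 h2 h3 h4 => by
        rw [← hc.src] at h1 h2 ⊢
        rw [← hc.tgt] at h3 h4 ⊢
        have h5 := hP (j e) (by
            simp only [Set.mem_compl_iff, Set.mem_insert_iff, Set.mem_singleton_iff, not_or]
            exact ⟨fun h => h1 (congrArg q h), fun h => h2 (congrArg q h)⟩) (by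
            simp only [Set.mem_compl_iff, Set.mem_insert_iff, Set.mem_singleton_iff, not_or]
            exact ⟨fun h => h3 (congrArg q h), fun h => h4 (congrArg q h)⟩)
        constructor
        · rintro ⟨w, hw, hPw⟩
          exact ⟨_, rfl, h5.1 (hfib w _ hw (hw ▸ h1) (hw ▸ h2) hPw)⟩
        · rintro ⟨w, hw, hPw⟩
          exact ⟨_, rfl, h5.2 (hfib w _ hw (hw ▸ h3) (hw ▸ h4) hPw)⟩)
      hxu hxv hyu hyv ⟨x, rfl, hx⟩
    exact hfib x' y hx' (hx' ▸ hyu) (hx' ▸ hyv) hPx'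
  obtain ⟨p, hp⟩ : ∃ p : Prop, ∀ x, q x ≠ q u → q x ≠ q v → (P x ↔ p) := by
    by_cases hex : ∃ x, q x ≠ q u ∧ q x ≠ q v
    · obtain ⟨x, h1, h2⟩ := hex
      exact ⟨P x, fun y h3 h4 => ⟨hK y x h3 h4 h1 h2, hK x y h1 h2 h3 h4⟩⟩
    · push Not at hex
      exact ⟨True, fun x h1 h2 => (h2 (hex x h1)).elim⟩
  have hA := hc.eq_empty_of_separated hH h3.1 hg hs hv u v
    (Finset.univ.filter fun x => x ≠ u ∧ x ≠ v ∧ ¬ (P x ↔ p)) (fun x hx => by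
      simp only [Finset.mem_filter, Finset.mem_univ, true_and] at hx
      by_contra! h
      exact hx.2.2 (hp x h.1 h.2)) (fun e => by
      have h1 := hP e
      simp only [Set.mem_compl_iff, Set.mem_insert_iff, Set.mem_singleton_iff, not_or] at h1
      simp only [Finset.mem_filter, Finset.mem_univ, true_and]
      constructor
      · rintro ⟨h2, h3, h4⟩
        by_contra! h5
        exact h4 ((h1 ⟨h2, h3⟩ h5.2).trans (not_not.1 fun h6 => h6 (h5.1 h5.2.1 h5.2.2)))
      · rintro ⟨h2, h3, h4⟩
        by_contra! h5
        exact h4 ((h1 h5.2 ⟨h2, h3⟩).symm.trans (not_not.1 fun h6 => h6 (h5.1 h5.2.1 h5.2.2))))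
  have hall : ∀ x ∈ ({u, v}ᶜ : Set H.V), (P x ↔ p) := by
    intro x hx
    simp only [Set.mem_compl_iff, Set.mem_insert_iff, Set.mem_singleton_iff, not_or] at hx
    by_contra h
    have : x ∈ (∅ : Finset H.V) := by
      rw [← hA]
      simpa using ⟨hx.1, hx.2, h⟩
    simp at this
  intro a ha b hb hPa
  rw [hall b hb, ← hall a ha]
  exact hPa

end IsContraction

end Multigraph

theorem WeightedGraph.comp_eq_comp_iff (G : WeightedGraph) (S : Set G.E) (a b : G.V) :
    G.comp S a = G.comp S b ↔
      ∀ P : G.V → Prop, (∀ e ∈ S, (P (G.src e) ↔ P (G.tgt e))) → P a → P b :=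
  SimpleGraph.ConnectedComponent.eq.trans (G.reachable_adjVia_iff S a b)

/-- Contracting more edges is a contraction of the contraction. -/
theorem WeightedGraph.exists_isContraction (G : WeightedGraph) {S T : Set G.E} (h : S ⊆ T) :
    ∃ (q : (G.contract S).V → (G.contract T).V) (j : (G.contract T).E → (G.contract S).E),
      Multigraph.IsContraction q j := by
  let q : (G.contract S).V → (G.contract T).V := fun c => c.lift (G.comp T) (by
    intro a b p _
    exact (G.comp_eq_comp_iff T a b).2 fun P hP => (G.reachable_adjVia_iff S a b).1 ⟨p⟩ P fun e he => hP e (h he))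
  have hq : ∀ a, q (G.comp S a) = G.comp T a := fun a => rfl
  refine ⟨q, fun e => ⟨e.1, fun he => e.2 (h he)⟩, ?_, ?_, fun e => hq _, fun e => hq _, ?_, ?_⟩
  · intro e f hef
    exact Subtype.ext (congrArg (fun x : (G.contract S).E => x.1) hef)
  · intro c
    obtain ⟨a, rfl⟩ : ∃ a, G.comp T a = c := Quot.exists_rep c
    exact ⟨G.comp S a, hq a⟩
  · intro e he
    have heT : e.1 ∈ T := by
      by_contra hT
      exact he ⟨⟨e.1, hT⟩, rfl⟩
    exact G.comp_src_eq_comp_tgt T heT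
  · intro c d hcd
    obtain ⟨a, rfl⟩ : ∃ a, G.comp S a = c := Quot.exists_rep c
    obtain ⟨b, rfl⟩ : ∃ b, G.comp S b = d := Quot.exists_rep d
    replace hcd := (G.comp_eq_comp_iff T a b).1 hcd
    refine (Multigraph.reachable_adjVia_iff _ _ _ _).2 fun P hP => ?_
    refine hcd (fun x => P (G.comp S x)) fun e he => ?_
    by_cases heS : e ∈ S
    · rw [G.comp_src_eq_comp_tgt S heS]
    · refine hP ⟨e, heS⟩ ?_
      rintro ⟨f, hf⟩
      have : f.1 = e := congrArg (fun x : (G.contract S).E => x.1) hf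
      exact f.2 (this ▸ he)

theorem isOpen_simpleThreeConnectedLocus (g : ℕ) : IsOpen (simpleThreeConnectedLocus g) := by
  refine isOpen_of_forall_support_subset ?_
  rintro G l l' hll' ⟨C, hC, hs, h3, hg⟩
  obtain ⟨σ, ψ, hσ, -⟩ := Quotient.exact hC.symm
  have hGc := (G.curveOf l).connected
  have hHc := (G.curveOf l').connected
  have hGs : (G.curveOf l).Simple := hs.of_iso σ ψ hσ
  have hG3 : (G.curveOf l).ThreeVertexConnected := h3.of_iso hGc σ ψ hσ
  have hGg : (G.curveOf l).genus = g := by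
    refine Eq.trans ?_ hg
    rw [Multigraph.genus, Multigraph.genus, Nat.card_congr σ, Nat.card_congr ψ]
  obtain ⟨q, j, hc⟩ := G.exists_isContraction (S := {e | l' e = 0}) (T := {e | l e = 0})
    fun e he => not_not.1 fun h => hll' e h he
  have hHg : (G.curveOf l').genus = g := by
    have h1 : (G.curveOf l).genus ≤ (G.curveOf l').genus := hc.genus_le hHc hGc
    have h2 := (G.curveOf l').wgenus_eq
    rw [WeightedGraph.wgenus] at h2
    omega
  have hgg : (G.curveOf l').genus = (G.curveOf l).genus := hHg.trans hGg.symm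
  exact ⟨G.curveOf l', rfl, hc.simple hHc hGc hgg hGs,
    hc.threeVertexConnected hHc hgg hGs hG3
      fun v => (G.curveOf l').stable v (TropicalCurve.w_eq_zero hHg v), hHg⟩

end TropicalTorelli

/-- The tropical Torelli map is injective on the locus of loopless `3`-vertex-connected tropical
curves of genus `g` with all weights zero. This locus is the union of finitely many strata of
`M_g^tr`, each of which is locally closed, and its part given by the simple graphs is locally
closed. -/
theorem corollaryC (g : ℕ) (hg : 2 ≤ g) :
    Set.InjOn (TropicalTorelli.torelli g) (TropicalTorelli.threeConnectedLocus g) ∧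
    (∃ 𝒮 : Set (Set (TropicalTorelli.Mtr g)), 𝒮.Finite ∧
      (∀ s ∈ 𝒮, IsLocallyClosed s ∧
        ∃ G : TropicalTorelli.StableGraph g, s = TropicalTorelli.stratum G) ∧
      TropicalTorelli.threeConnectedLocus g = ⋃₀ 𝒮) ∧
    IsLocallyClosed (TropicalTorelli.simpleThreeConnectedLocus g) := by
  exact ⟨TropicalTorelli.injOn_torelli g, TropicalTorelli.exists_finite_strata g,
    (TropicalTorelli.isOpen_simpleThreeConnectedLocus g).isLocallyClosed⟩
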